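/- Let $0<\beta<1/2$ and $0\le\theta\le1$. All functions are real-valued on $(0,1)$. Let $H^1(0,1)$ be the space of functions in $L^2(0,1)$ with weak derivative $Dw\in L^2(0,1)$. For $\mu>0$ put $$\|w\|_{H^\mu(\mathbb R)}=\bigl(\|w\|_{L^2(\mathbb R)}^2+\||\omega|^\mu\mathcal F(w)\|_{L^2(\mathbb R)}^2\bigr)^{1/2},$$ where $\mathcal F$ is the Fourier transform, and let $H^\mu_0(0,1)$ be the completion of $C_0^\infty(0,1)$ in this norm, that is, the space of those $u\in L^2(0,1)$ whose extension by zero to $\mathbb R$ is the limit in $\|\cdot\|_{H^\mu(\mathbb R)}$ of a sequence in $C_0^\infty(0,1)$. Define the two-sided fractional integral $$I^\beta_\theta\phi(x)=\frac{\theta}{\Gamma(\beta)}\int_0^x\frac{\phi(s)}{(x-s)^{1-\beta}}\,ds+\frac{1-\theta}{\Gamma(\beta)}\int_x^1\frac{\phi(s)}{(s-x)^{1-\beta}}\,ds$$ and $$\mathcal R(I^\beta_\theta)=\{w\in H^1(0,1):\ w=I^\beta_\theta\phi\ \text{for some}\ \phi\in H^{1-\beta}_0(0,1)\}.$$ There is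 exactly one map $P:H^1(0,1)\to H^1_0(0,1)$ such that $$(D Pw,Dv)_{L^2(0,1)}=(Dw,Dv)_{L^2(0,1)}\qquad\text{for all } w\in H^1(0,1),\ v\in H^1_0(0,1),$$ and it is linear. With $\mathcal N(P)=\{w\in H^1(0,1): Pw=0\}$ the following hold: $$\mathcal N(P)=\operatorname{span}\{1-x,\;x\},\qquad P\bigl(\mathcal R(I^\beta_\theta)\bigr)=H^1_0(0,1),\qquad H^1(0,1)=\mathcal R(I^\beta_\theta)\oplus\mathcal N(P).$$ -/

import Mathlib

open MeasureTheory Set Filter Topology FourierTransform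
open scoped ENNReal

namespace FracDiff

/-- Lebesgue measure on the open interval `(0, 1)`. -/
noncomputable abbrev vol01 : Measure ℝ := volume.restrict (Ioo (0 : ℝ) 1)

/-- The real Hilbert space `L²(0, 1)`. -/
noncomputable abbrev L2 : Type := Lp ℝ 2 vol01

/-- The open interval `(0, 1)` as a bundled open set. -/
def Omega : TopologicalSpace.Opens ℝ := ⟨Ioo (0 : ℝ) 1, isOpen_Ioo⟩

/-- `C₀^∞(0, 1)`: smooth real functions with compact support contained in `(0, 1)`.
The order `⊤ : ℕ∞` means infinitely differentiable. -/
abbrev Test : Type := TestFunction Omega ℝ (⊤ : ℕ∞)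

/-! ### Weak derivatives and `H¹(0, 1)` -/

/-- `g ∈ L²(0, 1)` is the weak derivative of `w ∈ L²(0, 1)` on `(0, 1)`. -/
def HasWeakDeriv (w g : L2) : Prop :=
  ∀ φ : Test, ∫ x in Ioo (0 : ℝ) 1, w x * deriv φ x = -∫ x in Ioo (0 : ℝ) 1, g x * φ x

theorem L2_integrable (w : L2) : Integrable w vol01 :=
  (Lp.memLp w).integrable (by norm_num)

theorem test_integrable (φ : Test) (w : L2) : Integrable (fun x => w x * φ x) vol01 := by
  obtain ⟨C, hC⟩ := φ.continuous.bounded_above_of_compact_support φ.hasCompactSupport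
  exact (L2_integrable w).mul_bdd (c := C) φ.continuous.aestronglyMeasurable (ae_of_all _ hC)

theorem test_deriv_integrable (φ : Test) (w : L2) :
    Integrable (fun x => w x * deriv φ x) vol01 := by
  have hc : Continuous (deriv φ) := φ.contDiff.continuous_deriv (by simp)
  obtain ⟨C, hC⟩ := hc.bounded_above_of_compact_support φ.hasCompactSupport.deriv
  exact (L2_integrable w).mul_bdd (c := C) hc.aestronglyMeasurable (ae_of_all _ hC)

theorem HasWeakDeriv.add {w g w' g' : L2} (h : HasWeakDeriv w g) (h' : HasWeakDeriv w' g') :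
    HasWeakDeriv (w + w') (g + g') := by
  intro φ
  have e1 : ∫ x in Ioo (0 : ℝ) 1, (w + w' : L2) x * deriv φ x
      = ∫ x in Ioo (0 : ℝ) 1, (w x * deriv φ x + w' x * deriv φ x) := by
    refine integral_congr_ae ?_
    filter_upwards [Lp.coeFn_add w w'] with x hx
    rw [hx, Pi.add_apply, add_mul]
  have e2 : ∫ x in Ioo (0 : ℝ) 1, (g + g' : L2) x * φ x
      = ∫ x in Ioo (0 : ℝ) 1, (g x * φ x + g' x * φ x) := by
    refine integral_congr_ae ?_
    filter_upwards [Lp.coeFn_add g g'] with x hx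
    rw [hx, Pi.add_apply, add_mul]
  rw [e1, e2, integral_add (test_deriv_integrable φ w) (test_deriv_integrable φ w'),
    integral_add (test_integrable φ g) (test_integrable φ g'), h φ, h' φ, neg_add]

theorem HasWeakDeriv.smul {w g : L2} (c : ℝ) (h : HasWeakDeriv w g) :
    HasWeakDeriv (c • w) (c • g) := by
  intro φ
  have e1 : ∫ x in Ioo (0 : ℝ) 1, (c • w : L2) x * deriv φ x
      = ∫ x in Ioo (0 : ℝ) 1, c * (w x * deriv φ x) := by
    refine integral_congr_ae ?_
    filter_upwards [Lp.coeFn_smul c w] with x hx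
    rw [hx, Pi.smul_apply, smul_eq_mul, mul_assoc]
  have e2 : ∫ x in Ioo (0 : ℝ) 1, (c • g : L2) x * φ x
      = ∫ x in Ioo (0 : ℝ) 1, c * (g x * φ x) := by
    refine integral_congr_ae ?_
    filter_upwards [Lp.coeFn_smul c g] with x hx
    rw [hx, Pi.smul_apply, smul_eq_mul, mul_assoc]
  rw [e1, e2, integral_const_mul, integral_const_mul, h φ, mul_neg]

/-- Weak derivatives are unique. -/
theorem HasWeakDeriv.unique {w g g' : L2} (h : HasWeakDeriv w g) (h' : HasWeakDeriv w g') :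
    g = g' := by
  have hloc : LocallyIntegrableOn (fun x => g x - g' x) (Ioo (0 : ℝ) 1) volume :=
    IntegrableOn.locallyIntegrableOn ((L2_integrable g).sub (L2_integrable g'))
  have key := isOpen_Ioo.ae_eq_zero_of_integral_contDiff_smul_eq_zero hloc (by
    intro φ h1 h2 h3
    let ψ : Test := ⟨φ, h1, h2, h3⟩
    have e : ∫ x in Ioo (0 : ℝ) 1, (g x * φ x - g' x * φ x) = 0 := by
      have := integral_sub (test_integrable ψ g) (test_integrable ψ g')
      have h4 := h ψ
      rw [h' ψ] at h4
      have h5 : ∫ x in Ioo (0 : ℝ) 1, g x * ψ x = ∫ x in Ioo (0 : ℝ) 1, g' x * ψ x := by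
        linarith
      rw [h5, sub_self] at this
      exact this
    rw [← e, ← integral_indicator measurableSet_Ioo]
    refine integral_congr_ae (ae_of_all _ fun x => ?_)
    by_cases hx : x ∈ Ioo (0 : ℝ) 1
    · simp only [indicator_of_mem hx, smul_eq_mul]; ring
    · have : φ x = 0 := by
        by_contra hne
        exact hx (h3 (subset_tsupport _ hne))
      simp [indicator_of_notMem hx, this])
  refine Lp.ext ?_
  filter_upwards [(ae_restrict_iff' measurableSet_Ioo).2 key] with x hx
  linarith

/-- `H¹(0, 1)`: the square integrable functions that have a square integrable weak derivative. -/
noncomputable def H1 : Submodule ℝ L2 where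
  carrier := {w | ∃ g : L2, HasWeakDeriv w g}
  add_mem' := by
    rintro w w' ⟨g, hg⟩ ⟨g', hg'⟩
    exact ⟨g + g', hg.add hg'⟩
  zero_mem' := by
    refine ⟨0, ?_⟩
    intro φ
    have e (f : ℝ → ℝ) : ∫ x in Ioo (0 : ℝ) 1, (0 : L2) x * f x = 0 := by
      refine integral_eq_zero_of_ae ?_
      filter_upwards [Lp.coeFn_zero ℝ 2 vol01] with x hx
      have hx' : (0 : L2) x = 0 := hx
      simp only [hx', zero_mul, Pi.zero_apply]
    rw [e, e, neg_zero]
  smul_mem' := by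
    rintro c w ⟨g, hg⟩
    exact ⟨c • g, hg.smul c⟩

/-- The weak derivative `D : H¹(0, 1) → L²(0, 1)`. -/
noncomputable def D : H1 →ₗ[ℝ] L2 where
  toFun w := w.2.choose
  map_add' w w' :=
    (w + w').2.choose_spec.unique (w.2.choose_spec.add w'.2.choose_spec)
  map_smul' c w := (c • w).2.choose_spec.unique (w.2.choose_spec.smul c)

theorem D_spec (w : H1) : HasWeakDeriv (w : L2) (D w) := w.2.choose_spec

/-! ### The spaces `H^μ₀(0, 1)` -/

/-- The seminorm `|f|_{H^μ(ℝ)} = ‖ |ω|^μ 𝓕 f ‖_{L²(ℝ)}` of an integrable function `f : ℝ → ℝ`.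
(Mathlib's `𝓕` uses the kernel `exp(-2πixω)`; the choice of normalisation
only changes the seminorm by a constant factor.) -/
noncomputable def sobolevSeminorm (μ : ℝ) (f : ℝ → ℝ) : ℝ≥0∞ :=
  eLpNorm (fun ω : ℝ => ((|ω| ^ μ : ℝ) : ℂ) * 𝓕 (fun x => (f x : ℂ)) ω) 2 volume

/-- The norm `‖f‖_{H^μ(ℝ)} = (‖f‖²_{L²(ℝ)} + |f|²_{H^μ(ℝ)})^{1/2}`. -/
noncomputable def sobolevNorm (μ : ℝ) (f : ℝ → ℝ) : ℝ≥0∞ :=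
  (eLpNorm f 2 volume ^ 2 + sobolevSeminorm μ f ^ 2) ^ (1 / 2 : ℝ)

/-- The extension of `u ∈ L²(0, 1)` by zero to the real line. -/
noncomputable def zeroExt (u : L2) : ℝ → ℝ := (Ioo (0 : ℝ) 1).indicator u

theorem zeroExt_integrable (u : L2) : Integrable (zeroExt u) :=
  (integrable_indicator_iff measurableSet_Ioo).2 (L2_integrable u)

theorem zeroExt_add (u v : L2) : zeroExt (u + v) =ᵐ[volume] zeroExt u + zeroExt v := by
  have := (ae_restrict_iff' measurableSet_Ioo).1 (Lp.coeFn_add u v)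
  filter_upwards [this] with x hx
  by_cases h : x ∈ Ioo (0 : ℝ) 1
  · simpa only [zeroExt, indicator_of_mem h, Pi.add_apply, Pi.smul_apply] using hx h
  · simp [zeroExt, indicator_of_notMem h]

theorem zeroExt_smul (c : ℝ) (u : L2) : zeroExt (c • u) =ᵐ[volume] c • zeroExt u := by
  have := (ae_restrict_iff' measurableSet_Ioo).1 (Lp.coeFn_smul c u)
  filter_upwards [this] with x hx
  by_cases h : x ∈ Ioo (0 : ℝ) 1
  · simpa only [zeroExt, indicator_of_mem h, Pi.add_apply, Pi.smul_apply] using hx h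
  · simp [zeroExt, indicator_of_notMem h]

theorem sobolevSeminorm_congr (μ : ℝ) {f g : ℝ → ℝ} (h : f =ᵐ[volume] g) :
    sobolevSeminorm μ f = sobolevSeminorm μ g := by
  have : 𝓕 (fun x => (f x : ℂ)) = 𝓕 (fun x => (g x : ℂ)) := by
    ext ω
    rw [Real.fourier_eq, Real.fourier_eq]
    refine integral_congr_ae ?_
    filter_upwards [h] with x hx
    simp only [hx]
  rw [sobolevSeminorm, sobolevSeminorm, this]

theorem sobolevNorm_congr (μ : ℝ) {f g : ℝ → ℝ} (h : f =ᵐ[volume] g) :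
    sobolevNorm μ f = sobolevNorm μ g := by
  rw [sobolevNorm, sobolevNorm, sobolevSeminorm_congr μ h, eLpNorm_congr_ae h]

theorem fourier_aesm {f : ℝ → ℝ} (hf : Integrable f) (μ : ℝ) :
    AEStronglyMeasurable
      (fun ω : ℝ => ((|ω| ^ μ : ℝ) : ℂ) * 𝓕 (fun x => (f x : ℂ)) ω) volume := by
  have h1 : Continuous (𝓕 (fun x => (f x : ℂ))) :=
    VectorFourier.fourierIntegral_continuous Real.continuous_fourierChar
      (by exact continuous_inner) hf.ofReal
  have h2 : Measurable (fun ω : ℝ => ((|ω| ^ μ : ℝ) : ℂ)) := by fun_prop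
  exact h2.aestronglyMeasurable.mul h1.aestronglyMeasurable

theorem sobolevSeminorm_add_le (μ : ℝ) {f g : ℝ → ℝ} (hf : Integrable f) (hg : Integrable g) :
    sobolevSeminorm μ (f + g) ≤ sobolevSeminorm μ f + sobolevSeminorm μ g := by
  have e : (fun ω : ℝ => ((|ω| ^ μ : ℝ) : ℂ) * 𝓕 (fun x => ((f + g) x : ℂ)) ω)
      = (fun ω : ℝ => ((|ω| ^ μ : ℝ) : ℂ) * 𝓕 (fun x => (f x : ℂ)) ω)
        + fun ω : ℝ => ((|ω| ^ μ : ℝ) : ℂ) * 𝓕 (fun x => (g x : ℂ)) ω := by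
    ext ω
    have : 𝓕 (fun x => ((f + g) x : ℂ)) ω
        = 𝓕 (fun x => (f x : ℂ)) ω + 𝓕 (fun x => (g x : ℂ)) ω := by
      rw [Real.fourier_eq, Real.fourier_eq, Real.fourier_eq, ← integral_add]
      · simp [smul_add]
      · exact (Real.fourierIntegral_convergent_iff ω).2 hf.ofReal
      · exact (Real.fourierIntegral_convergent_iff ω).2 hg.ofReal
    simp only [Pi.add_apply] at this ⊢
    rw [this, mul_add]
  rw [sobolevSeminorm, e]
  exact eLpNorm_add_le (fourier_aesm hf μ) (fourier_aesm hg μ) (by norm_num)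

theorem sobolevSeminorm_smul (μ c : ℝ) (f : ℝ → ℝ) :
    sobolevSeminorm μ (c • f) = ‖c‖ₑ * sobolevSeminorm μ f := by
  have e : (fun ω : ℝ => ((|ω| ^ μ : ℝ) : ℂ) * 𝓕 (fun x => ((c • f) x : ℂ)) ω)
      = c • (fun ω : ℝ => ((|ω| ^ μ : ℝ) : ℂ) * 𝓕 (fun x => (f x : ℂ)) ω) := by
    ext ω
    have : 𝓕 (fun x => ((c • f) x : ℂ)) ω = c * 𝓕 (fun x => (f x : ℂ)) ω := by
      rw [Real.fourier_eq, Real.fourier_eq, ← integral_const_mul]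
      refine integral_congr_ae (ae_of_all _ fun x => ?_)
      simp only [Pi.smul_apply, smul_eq_mul, Complex.ofReal_mul, Circle.smul_def]
      ring
    simp only [Pi.smul_apply, Complex.real_smul] at this ⊢
    rw [this]
    ring
  rw [sobolevSeminorm, e, eLpNorm_const_smul, sobolevSeminorm]

theorem tendsto_sobolevNorm_iff {μ : ℝ} {F : ℕ → ℝ → ℝ} :
    Tendsto (fun n => sobolevNorm μ (F n)) atTop (𝓝 0) ↔
      Tendsto (fun n => eLpNorm (F n) 2 volume) atTop (𝓝 0) ∧
      Tendsto (fun n => sobolevSeminorm μ (F n)) atTop (𝓝 0) := by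
  have hs (a : ℝ≥0∞) : (a ^ 2) ^ (1 / 2 : ℝ) = a := by
    rw [← ENNReal.rpow_natCast, ← ENNReal.rpow_mul]
    norm_num
  constructor
  · intro h
    refine ⟨tendsto_of_tendsto_of_tendsto_of_le_of_le tendsto_const_nhds h
      (fun _ => zero_le) fun n => ?_,
      tendsto_of_tendsto_of_tendsto_of_le_of_le tendsto_const_nhds h
      (fun _ => zero_le) fun n => ?_⟩
    · exact (hs _).symm.le.trans (ENNReal.rpow_le_rpow le_self_add (by norm_num))
    · exact (hs _).symm.le.trans (ENNReal.rpow_le_rpow le_add_self (by norm_num))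
  · rintro ⟨h1, h2⟩
    have h3 := ((ENNReal.continuous_rpow_const (y := (1 / 2 : ℝ))).tendsto _).comp
      (((ENNReal.continuous_pow 2).tendsto _).comp h1 |>.add
        (((ENNReal.continuous_pow 2).tendsto _).comp h2))
    simpa [Function.comp_def, sobolevNorm] using h3

theorem test_integrable' (φ : Test) : Integrable (φ : ℝ → ℝ) :=
  φ.continuous.integrable_of_hasCompactSupport φ.hasCompactSupport

/-- `H^μ₀(0, 1)`: the completion of `C₀^∞(0, 1)` for the norm `‖·‖_{H^μ(ℝ)}`, realised inside
`L²(0, 1)` as the set of all `u` whose extension by zero is the limit, in the norm of `H^μ(ℝ)`,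
of a sequence of test functions. -/
noncomputable def Hzero (μ : ℝ) : Submodule ℝ L2 where
  carrier := {u | ∃ φ : ℕ → Test,
    Tendsto (fun n => sobolevNorm μ (⇑(φ n) - zeroExt u)) atTop (𝓝 0)}
  add_mem' := by
    rintro u v ⟨φ, hφ⟩ ⟨ψ, hψ⟩
    refine ⟨fun n => φ n + ψ n, ?_⟩
    have e (n : ℕ) : sobolevNorm μ (⇑(φ n + ψ n) - zeroExt (u + v))
        = sobolevNorm μ ((⇑(φ n) - zeroExt u) + (⇑(ψ n) - zeroExt v)) := by
      refine sobolevNorm_congr μ ?_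
      filter_upwards [zeroExt_add u v] with x hx
      simp only [Pi.sub_apply, Pi.add_apply, hx, FunLike.coe_add]
      ring
    simp only [e]
    have iφ (n : ℕ) := (test_integrable' (φ n)).sub (zeroExt_integrable u)
    have iψ (n : ℕ) := (test_integrable' (ψ n)).sub (zeroExt_integrable v)
    rw [tendsto_sobolevNorm_iff] at hφ hψ ⊢
    constructor
    · refine tendsto_of_tendsto_of_tendsto_of_le_of_le tendsto_const_nhds
        (by simpa using hφ.1.add hψ.1) (fun _ => zero_le) fun n => ?_
      exact eLpNorm_add_le (iφ n).aestronglyMeasurable (iψ n).aestronglyMeasurable (by norm_num)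
    · refine tendsto_of_tendsto_of_tendsto_of_le_of_le tendsto_const_nhds
        (by simpa using hφ.2.add hψ.2) (fun _ => zero_le) fun n => ?_
      exact sobolevSeminorm_add_le μ (iφ n) (iψ n)
  zero_mem' := by
    refine ⟨fun _ => 0, ?_⟩
    have e : sobolevNorm μ (⇑(0 : Test) - zeroExt 0) = 0 := by
      have e1 : sobolevNorm μ (⇑(0 : Test) - zeroExt 0)
          = sobolevNorm μ ((0 : ℝ) • (0 : ℝ → ℝ)) := by
        refine sobolevNorm_congr μ ?_
        filter_upwards [zeroExt_smul 0 0] with x hx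
        simp only [zero_smul, Pi.zero_apply, Pi.sub_apply] at hx ⊢
        rw [hx, sub_zero, FunLike.coe_zero, Pi.zero_apply]
      rw [e1, sobolevNorm, sobolevSeminorm_smul]
      simp
    rw [tendsto_congr fun _ => e]
    exact tendsto_const_nhds
  smul_mem' := by
    rintro c u ⟨φ, hφ⟩
    refine ⟨fun n => c • φ n, ?_⟩
    have e (n : ℕ) : sobolevNorm μ (⇑(c • φ n) - zeroExt (c • u))
        = sobolevNorm μ (c • (⇑(φ n) - zeroExt u)) := by
      refine sobolevNorm_congr μ ?_
      filter_upwards [zeroExt_smul c u] with x hx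
      simp only [Pi.sub_apply, Pi.smul_apply, hx, FunLike.coe_smul, smul_eq_mul]
      ring
    simp only [e]
    rw [tendsto_sobolevNorm_iff] at hφ ⊢
    simp only [sobolevSeminorm_smul, eLpNorm_const_smul]
    exact ⟨by simpa using ENNReal.Tendsto.const_mul hφ.1 (Or.inr (enorm_ne_top (x := c))),
      by simpa using ENNReal.Tendsto.const_mul hφ.2 (Or.inr (enorm_ne_top (x := c)))⟩

/-- `H¹₀(0, 1)` as a subspace of `H¹(0, 1)`. -/
noncomputable def H10 : Submodule ℝ H1 := (Hzero 1).comap H1.subtype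

/-! ### The two-sided fractional integral and its range -/

/-- The left fractional integral of order `σ` on `(0, 1)`. -/
noncomputable def leftInt (σ : ℝ) (w : ℝ → ℝ) (x : ℝ) : ℝ :=
  1 / Real.Gamma σ * ∫ s in Ioo 0 x, w s / (x - s) ^ (1 - σ)

/-- The right fractional integral of order `σ` on `(0, 1)`. -/
noncomputable def rightInt (σ : ℝ) (w : ℝ → ℝ) (x : ℝ) : ℝ :=
  1 / Real.Gamma σ * ∫ s in Ioo x 1, w s / (s - x) ^ (1 - σ)

/-- The two-sided fractional integral `I^β_θ`. -/
noncomputable def fracInt (β θ : ℝ) (w : ℝ → ℝ) (x : ℝ) : ℝ :=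
  θ * leftInt β w x + (1 - θ) * rightInt β w x

theorem ae_integrable_left {β : ℝ} (hβ : 0 < β) (w : L2) :
    ∀ᵐ x ∂vol01, IntegrableOn (fun s => w s / (x - s) ^ (1 - β)) (Ioo 0 x) := by
  have hk : Integrable ((Ioo (0 : ℝ) 1).indicator fun t => t ^ (β - 1)) :=
    (integrable_indicator_iff measurableSet_Ioo).2
      ((intervalIntegral.integrableOn_Ioo_rpow_iff one_pos).2 (by linarith))
  have h := (zeroExt_integrable w).ae_convolution_exists (ContinuousLinearMap.mul ℝ ℝ) hk
  refine (ae_restrict_iff' measurableSet_Ioo).2 ?_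
  filter_upwards [h] with x hx hx01
  refine (Integrable.integrableOn (s := Ioo 0 x) hx).congr_fun (fun s hs => ?_) measurableSet_Ioo
  have h1 : s ∈ Ioo (0 : ℝ) 1 := ⟨hs.1, hs.2.trans hx01.2⟩
  have h2 : x - s ∈ Ioo (0 : ℝ) 1 := ⟨sub_pos.2 hs.2, by linarith [hs.1, hx01.2]⟩
  simp only [ContinuousLinearMap.mul_apply', zeroExt, indicator_of_mem h1, indicator_of_mem h2]
  rw [div_eq_mul_inv, ← Real.rpow_neg h2.1.le, neg_sub]

theorem ae_integrable_right {β : ℝ} (hβ : 0 < β) (w : L2) :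
    ∀ᵐ x ∂vol01, IntegrableOn (fun s => w s / (s - x) ^ (1 - β)) (Ioo x 1) := by
  have hk0 : Integrable ((Ioo (0 : ℝ) 1).indicator fun t => t ^ (β - 1)) :=
    (integrable_indicator_iff measurableSet_Ioo).2
      ((intervalIntegral.integrableOn_Ioo_rpow_iff one_pos).2 (by linarith))
  have hk := hk0.comp_neg
  have h := (zeroExt_integrable w).ae_convolution_exists (ContinuousLinearMap.mul ℝ ℝ) hk
  refine (ae_restrict_iff' measurableSet_Ioo).2 ?_
  filter_upwards [h] with x hx hx01
  refine (Integrable.integrableOn (s := Ioo x 1) hx).congr_fun (fun s hs => ?_) measurableSet_Ioo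
  have h1 : s ∈ Ioo (0 : ℝ) 1 := ⟨hx01.1.trans hs.1, hs.2⟩
  have h2 : s - x ∈ Ioo (0 : ℝ) 1 := ⟨sub_pos.2 hs.1, by linarith [hs.2, hx01.1]⟩
  simp only [ContinuousLinearMap.mul_apply', zeroExt, neg_sub, indicator_of_mem h1,
    indicator_of_mem h2]
  rw [div_eq_mul_inv, ← Real.rpow_neg h2.1.le, neg_sub]

theorem fracInt_add {β θ : ℝ} (hβ : 0 < β) (u v : L2) :
    fracInt β θ (u + v : L2) =ᵐ[vol01] fracInt β θ u + fracInt β θ v := by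
  have h0 := (ae_restrict_iff' measurableSet_Ioo).1 (Lp.coeFn_add u v)
  filter_upwards [ae_integrable_left hβ u, ae_integrable_left hβ v, ae_integrable_right hβ u,
    ae_integrable_right hβ v, ae_restrict_mem measurableSet_Ioo] with x h1 h2 h3 h4 hx
  have e1 : leftInt β (u + v : L2) x = leftInt β u x + leftInt β v x := by
    rw [leftInt, leftInt, leftInt, ← mul_add, ← integral_add h1 h2]
    congr 1
    refine setIntegral_congr_ae measurableSet_Ioo ?_
    filter_upwards [h0] with s hs hs'
    rw [hs ⟨hs'.1, hs'.2.trans hx.2⟩, Pi.add_apply, add_div]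
  have e2 : rightInt β (u + v : L2) x = rightInt β u x + rightInt β v x := by
    rw [rightInt, rightInt, rightInt, ← mul_add, ← integral_add h3 h4]
    congr 1
    refine setIntegral_congr_ae measurableSet_Ioo ?_
    filter_upwards [h0] with s hs hs'
    rw [hs ⟨hx.1.trans hs'.1, hs'.2⟩, Pi.add_apply, add_div]
  simp only [fracInt, Pi.add_apply, e1, e2]
  ring

theorem fracInt_smul {β θ : ℝ} (c : ℝ) (u : L2) :
    fracInt β θ (c • u : L2) =ᵐ[vol01] c • fracInt β θ u := by
  have h0 := (ae_restrict_iff' measurableSet_Ioo).1 (Lp.coeFn_smul c u)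
  filter_upwards [ae_restrict_mem measurableSet_Ioo] with x hx
  have e1 : leftInt β (c • u : L2) x = c * leftInt β u x := by
    rw [leftInt, leftInt, mul_left_comm c, ← integral_const_mul c]
    congr 1
    refine setIntegral_congr_ae measurableSet_Ioo ?_
    filter_upwards [h0] with s hs hs'
    rw [hs ⟨hs'.1, hs'.2.trans hx.2⟩, Pi.smul_apply, smul_eq_mul, mul_div_assoc]
  have e2 : rightInt β (c • u : L2) x = c * rightInt β u x := by
    rw [rightInt, rightInt, mul_left_comm c, ← integral_const_mul c]
    congr 1
    refine setIntegral_congr_ae measurableSet_Ioo ?_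
    filter_upwards [h0] with s hs hs'
    rw [hs ⟨hx.1.trans hs'.1, hs'.2⟩, Pi.smul_apply, smul_eq_mul, mul_div_assoc]
  simp only [fracInt, Pi.smul_apply, smul_eq_mul, e1, e2]
  ring

/-- The range `R(I^β_θ)`: all `w ∈ H¹(0, 1)` of the form `w = I^β_θ φ` (almost everywhere) with
`φ ∈ H^{1-β}₀(0, 1)`. -/
noncomputable def fracRange (β θ : ℝ) (hβ : 0 < β) : Submodule ℝ H1 where
  carrier := {w | ∃ φ ∈ Hzero (1 - β), ((w : L2) : ℝ → ℝ) =ᵐ[vol01] fracInt β θ φ}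
  add_mem' := by
    rintro w w' ⟨φ, hφ, h⟩ ⟨φ', hφ', h'⟩
    refine ⟨φ + φ', add_mem hφ hφ', ?_⟩
    filter_upwards [Lp.coeFn_add (w : L2) (w' : L2), fracInt_add (θ := θ) hβ φ φ', h, h']
      with x h1 h2 h3 h4
    rw [Submodule.coe_add, h1, h2, Pi.add_apply, Pi.add_apply, h3, h4]
  zero_mem' := by
    refine ⟨0, zero_mem _, ?_⟩
    have h2 := fracInt_smul (β := β) (θ := θ) 0 0
    rw [zero_smul, zero_smul] at h2
    filter_upwards [Lp.coeFn_zero ℝ 2 vol01, h2] with x h1 h2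
    rw [ZeroMemClass.coe_zero, h1, h2]
  smul_mem' := by
    rintro c w ⟨φ, hφ, h⟩
    refine ⟨c • φ, Submodule.smul_mem _ c hφ, ?_⟩
    filter_upwards [Lp.coeFn_smul c (w : L2), fracInt_smul (β := β) (θ := θ) c φ, h]
      with x h1 h2 h3
    rw [Submodule.coe_smul, h1, h2, Pi.smul_apply, Pi.smul_apply, h3]

/-! ### The projection and the two affine functions -/

/-- `P : H¹(0, 1) → H¹₀(0, 1)` is the `H¹`-projection:
`(D P w, D v)_{L²(0,1)} = (D w, D v)_{L²(0,1)}` for all `w ∈ H¹(0, 1)` and `v ∈ H¹₀(0, 1)`. -/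
def IsH1Projection (P : H1 → H10) : Prop :=
  ∀ (w : H1) (v : H10), inner ℝ (D (P w : H1)) (D (v : H1)) = inner ℝ (D w) (D (v : H1))

theorem memLp_of_continuous {f : ℝ → ℝ} (hf : Continuous f) : MemLp f 2 vol01 := by
  obtain ⟨C, hC⟩ := (isCompact_Icc (a := (0 : ℝ)) (b := 1)).exists_bound_of_continuousOn
    hf.continuousOn
  refine MemLp.of_bound hf.aestronglyMeasurable C ?_
  filter_upwards [ae_restrict_mem measurableSet_Ioo] with x hx
  exact hC x (Ioo_subset_Icc_self hx)

/-- The function `w_l^c(x) = 1 - x` on `(0, 1)`. -/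
noncomputable def wl : L2 := (memLp_of_continuous (f := fun x => 1 - x) (by fun_prop)).toLp _

/-- The function `w_r^c(x) = x` on `(0, 1)`. -/
noncomputable def wr : L2 := (memLp_of_continuous (f := fun x => x) (by fun_prop)).toLp _

end FracDiff

namespace FracDiff

open scoped Convolution ComplexConjugate

/-! ### The Laplace transform of a power -/

/-! Everything is read off from weak derivatives. Differentiation maps `H10` isomorphically onto the
mean-zero functions of L² (`derivEquiv`), so the projection is forced: its derivative is `D w` minus
its mean (`D_h1Projection`). Its kernel consists of the functions with constant derivative. The two
remaining claims say that the derivatives of functions in `fracRange` together with the constants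
fill L², and that no function of `fracRange` other than zero has a constant derivative.

For a test function φ let a and b be the derivatives of its left and right fractional integrals. Up
to normalisation their Fourier symbols on φ' are (iω)^(-β) and its conjugate. Parseval's identity
gives ⟨a, b⟩ ≥ cos(βπ) times the squared seminorm of φ of order 1-β, up to a power of 2π
(`le_inner_pairDeriv`). This is where β < 1/2 enters: the cosine is positive. Hence the closure
`pairSpace` of the pairs (a, b) is a copy of the space of order 1-β. On it T_θ = θa + (1-θ)b, which
is `pairOp`, is bounded below uniformly in θ (`norm_le_pairOp`), because pairing T_θ(a, b) with a +
b yields at least ⟨a, b⟩.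

Filling L²: the range of T_θ is closed, and so is its sum with the constants. A mean-zero h
orthogonal to the range is a limit of derivatives φ_n'. The bound ⟨T_θ φ, φ'⟩ ≥ c |φ|² in the
seminorm of order 1-β/2 then forces φ_n → 0 in L², hence h = 0 (`eq_zero_of_inner_pairOp_eq_zero`).

Trivial intersection: if a nonzero constant were in the range of T_θ, then T_θ would be onto. By the
uniform lower bound and the method of continuity (`surjective_of_continuity`), T_1 would be onto as
well. But the range of T_1 is orthogonal to (1-x)^(-β), whose right fractional integral is constant
(`inner_edgeL2_pairDeriv`). This contradiction is `eq_zero_of_pairOp_eq_smul`. -/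

theorem integrableOn_rpow_mul_exp {β r : ℝ} (hβ : 0 < β) (hr : 0 < r) :
    IntegrableOn (fun t : ℝ => t ^ (β - 1) * Real.exp (-(r * t))) (Ioi 0) := by
  simpa using integrableOn_rpow_mul_exp_neg_mul_rpow (p := 1) (s := β - 1) (b := r)
    (by linarith) one_pos hr

/-- The measure `t^(β-1) dt` on `(0, ∞)`. -/
noncomputable def powMeasure (β : ℝ) : Measure ℝ :=
  (volume.restrict (Ioi (0 : ℝ))).withDensity fun t => ENNReal.ofReal (t ^ (β - 1))

theorem integrable_powMeasure_iff {β : ℝ} {E : Type*} [NormedAddCommGroup E] [NormedSpace ℝ E]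
    {g : ℝ → E} :
    Integrable g (powMeasure β) ↔ IntegrableOn (fun t : ℝ => (t ^ (β - 1)) • g t) (Ioi 0) := by
  rw [powMeasure, integrable_withDensity_iff_integrable_smul' (by fun_prop) (by simp)]
  refine integrable_congr ?_
  filter_upwards [ae_restrict_mem measurableSet_Ioi] with t ht
  rw [ENNReal.toReal_ofReal (Real.rpow_nonneg (le_of_lt ht) _)]

theorem integral_powMeasure {β : ℝ} {E : Type*} [NormedAddCommGroup E] [NormedSpace ℝ E]
    (g : ℝ → E) :
    ∫ t, g t ∂(powMeasure β) = ∫ t in Ioi (0 : ℝ), (t ^ (β - 1)) • g t := by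
  rw [powMeasure, integral_withDensity_eq_integral_toReal_smul (by fun_prop) (by simp)]
  refine setIntegral_congr_fun measurableSet_Ioi fun t ht => ?_
  rw [ENNReal.toReal_ofReal (Real.rpow_nonneg (le_of_lt ht) _)]

/-- Both sides are analytic in the left half plane and agree on the negative real axis by the real
Gamma integral, so the identity theorem applies. Writing the Laplace integral as a moment generating
function supplies its analyticity. -/
theorem complexMGF_powMeasure {β : ℝ} (hβ : 0 < β) {z : ℂ} (hz : z.re < 0) :
    ProbabilityTheory.complexMGF id (powMeasure β) z = Real.Gamma β * (-z) ^ (-(β : ℂ)) := by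
  have hsub : {z : ℂ | z.re < 0} ⊆
      {z | z.re ∈ interior (ProbabilityTheory.integrableExpSet id (powMeasure β))} := by
    intro z hz
    refine mem_interior.2 ⟨Iio 0, ?_, isOpen_Iio, hz⟩
    intro t ht
    have := integrableOn_rpow_mul_exp hβ (neg_pos.2 ht)
    simpa [ProbabilityTheory.integrableExpSet, integrable_powMeasure_iff] using this
  have ho : IsOpen {z : ℂ | z.re < 0} := isOpen_lt Complex.continuous_re continuous_const
  have h1 : AnalyticOnNhd ℂ (ProbabilityTheory.complexMGF id (powMeasure β)) {z | z.re < 0} :=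
    ProbabilityTheory.analyticOnNhd_complexMGF.mono hsub
  have h2 : AnalyticOnNhd ℂ (fun z : ℂ => Real.Gamma β * (-z) ^ (-(β : ℂ))) {z | z.re < 0} := by
    refine DifferentiableOn.analyticOnNhd (fun z hz => ?_) ho
    refine DifferentiableAt.differentiableWithinAt ?_
    refine DifferentiableAt.const_mul (DifferentiableAt.cpow_const (by fun_prop) ?_) _
    left
    simpa using hz
  have hc : IsPreconnected {z : ℂ | z.re < 0} :=
    (convex_halfSpace_re_lt 0).isPreconnected
  refine h1.eqOn_of_preconnected_of_frequently_eq h2 hc (z₀ := -1) (by simp) ?_ hz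
  have hreal : ∀ r : ℝ, 0 < r → ProbabilityTheory.complexMGF id (powMeasure β) (-(r : ℂ))
      = Real.Gamma β * (r : ℂ) ^ (-(β : ℂ)) := by
    intro r hr
    have := Complex.integral_cpow_mul_exp_neg_mul_Ioi (a := β) (by simpa using hβ) hr
    rw [ProbabilityTheory.complexMGF, integral_powMeasure]
    rw [Complex.Gamma_ofReal, one_div, Complex.inv_cpow _ _ (by
      rw [Complex.arg_ofReal_of_nonneg hr.le]; exact Real.pi_pos.ne), ← Complex.cpow_neg] at this
    rw [mul_comm, ← this]
    refine setIntegral_congr_fun measurableSet_Ioi fun t ht => ?_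
    simp only [id, Complex.real_smul]
    rw [Complex.ofReal_cpow (le_of_lt ht)]
    push_cast
    ring_nf
  -- Real points accumulating at -1 without reaching it, as the identity theorem requires.
  have ht : Tendsto (fun n : ℕ => (-((1 + 1 / ((n : ℝ) + 1) : ℝ) : ℂ))) atTop (𝓝[≠] (-1)) := by
    refine tendsto_nhdsWithin_iff.2 ⟨?_, Eventually.of_forall fun n => ?_⟩
    · have h3 : Tendsto (fun n : ℕ => (1 + 1 / ((n : ℝ) + 1) : ℝ)) atTop (𝓝 (1 + 0)) :=
        tendsto_const_nhds.add tendsto_one_div_add_atTop_nhds_zero_nat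
      have := ((Complex.continuous_ofReal.tendsto _).comp h3).neg
      simpa [Function.comp_def] using this
    · have : (0 : ℝ) < 1 / ((n : ℝ) + 1) := by positivity
      simp only [mem_compl_iff, mem_singleton_iff, neg_inj]
      intro h
      have h4 : (1 + 1 / ((n : ℝ) + 1) : ℝ) = 1 := by exact_mod_cast h
      linarith
  refine ht.frequently (Frequently.of_forall fun n => ?_)
  rw [hreal _ (by positivity), neg_neg]

/-- `∫₀^∞ t^(β-1) e^(-zt) dt = Γ(β) z^(-β)` for complex `z` with positive real part. -/
theorem integral_rpow_mul_cexp {β : ℝ} (hβ : 0 < β) {z : ℂ} (hz : 0 < z.re) :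
    ∫ t in Ioi (0 : ℝ), ((t ^ (β - 1) : ℝ) : ℂ) * Complex.exp (-(z * t))
      = Real.Gamma β * z ^ (-(β : ℂ)) := by
  have := complexMGF_powMeasure hβ (z := -z) (by simpa using hz)
  rw [neg_neg, ProbabilityTheory.complexMGF, integral_powMeasure] at this
  simpa using this

/-- The lower bound on the real part of a negative power in the right half plane. -/
theorem le_re_cpow_neg {z : ℂ} (hz : 0 < z.re) {s : ℝ} (hs0 : 0 ≤ s) (hs1 : s ≤ 1) :
    Real.cos (s * (Real.pi / 2)) * ‖z‖ ^ (-s) ≤ (z ^ (-(s : ℂ))).re := by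
  have hz0 : z ≠ 0 := by rintro rfl; simp at hz
  have harg : |z.arg| ≤ Real.pi / 2 := (Complex.abs_arg_lt_pi_div_two_iff.2 (Or.inl hz)).le
  rw [← Complex.ofReal_neg, Complex.cpow_ofReal_re, mul_comm]
  refine mul_le_mul_of_nonneg_left ?_ (Real.rpow_nonneg (norm_nonneg _) _)
  rw [← Real.cos_abs (z.arg * -s), abs_mul, abs_neg, abs_of_nonneg hs0, mul_comm]
  refine Real.cos_le_cos_of_nonneg_of_le_pi (by positivity) ?_ (by gcongr)
  nlinarith [Real.pi_pos]

theorem norm_cpow_neg_ofReal {z : ℂ} (hz : 0 < z.re) (s : ℝ) :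
    ‖z ^ (-(s : ℂ))‖ = ‖z‖ ^ (-s) := by
  have hz0 : z ≠ 0 := by rintro rfl; simp at hz
  rw [← Complex.ofReal_neg, Complex.norm_cpow_real]

/-! ### Kernels -/

/-- The kernel `t^(β-1) e^(-εt) / Γ(β)` on the positive half line. -/
noncomputable def dampedKernel (β ε : ℝ) : ℝ → ℝ :=
  (Ioi (0 : ℝ)).indicator fun t => t ^ (β - 1) * Real.exp (-(ε * t)) / Real.Gamma β

/-- The kernel `t^(β-1) / Γ(β)` on `(0, 1)`. -/
noncomputable def unitKernel (β : ℝ) : ℝ → ℝ :=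
  (Ioo (0 : ℝ) 1).indicator fun t => t ^ (β - 1) / Real.Gamma β

theorem integrable_dampedKernel {β ε : ℝ} (hβ : 0 < β) (hε : 0 < ε) :
    Integrable (dampedKernel β ε) :=
  (integrable_indicator_iff measurableSet_Ioi).2 ((integrableOn_rpow_mul_exp hβ hε).div_const _)

theorem integrable_unitKernel {β : ℝ} (hβ : 0 < β) : Integrable (unitKernel β) :=
  (integrable_indicator_iff measurableSet_Ioo).2
    (((intervalIntegral.integrableOn_Ioo_rpow_iff one_pos).2 (by linarith)).div_const _)

/-- Damping makes the half-line kernel integrable, so that it has an explicit Fourier transform.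
This domination allows the damping to be removed again by dominated convergence. -/
theorem norm_dampedKernel_le {β ε : ℝ} (hβ : 0 < β) (hε : 0 < ε) {t : ℝ} (ht : t < 1) :
    ‖dampedKernel β ε t‖ ≤ ‖unitKernel β t‖ := by
  by_cases h : 0 < t
  · have h1 := Real.Gamma_pos_of_pos hβ
    have h2 := Real.rpow_pos_of_pos h (β - 1)
    rw [dampedKernel, unitKernel, indicator_of_mem (mem_Ioi.2 h),
      indicator_of_mem (show t ∈ Ioo (0 : ℝ) 1 from ⟨h, ht⟩),
      Real.norm_of_nonneg (by positivity), Real.norm_of_nonneg (by positivity)]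
    gcongr
    refine mul_le_of_le_one_right h2.le (Real.exp_le_one_iff.2 ?_)
    have := mul_pos hε h
    linarith
  · rw [dampedKernel, indicator_of_notMem (by simpa using h), norm_zero]
    positivity

theorem tendsto_dampedKernel (β : ℝ) {t : ℝ} (ht : t < 1) {e : ℕ → ℝ}
    (he : Tendsto e atTop (𝓝 0)) :
    Tendsto (fun n => dampedKernel β (e n) t) atTop (𝓝 (unitKernel β t)) := by
  by_cases h : 0 < t
  · simp only [dampedKernel, unitKernel, indicator_of_mem (mem_Ioi.2 h),
      indicator_of_mem (show t ∈ Ioo (0 : ℝ) 1 from ⟨h, ht⟩)]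
    have h1 : Tendsto (fun n => t ^ (β - 1) * Real.exp (-(e n * t)) / Real.Gamma β) atTop
        (𝓝 (t ^ (β - 1) * Real.exp (-(0 * t)) / Real.Gamma β)) :=
      (((Real.continuous_exp.tendsto _).comp (he.mul_const t).neg).const_mul _).div_const _
    simpa using h1
  · have h1 : t ∉ Ioi (0 : ℝ) := by simpa using h
    have h2 : t ∉ Ioo (0 : ℝ) 1 := fun h' => h h'.1
    simp only [dampedKernel, unitKernel, indicator_of_notMem h1, indicator_of_notMem h2]
    exact tendsto_const_nhds

theorem fourier_dampedKernel {β ε : ℝ} (hβ : 0 < β) (hε : 0 < ε) (ω : ℝ) :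
    𝓕 (fun t => (dampedKernel β ε t : ℂ)) ω
      = ((ε : ℂ) + 2 * Real.pi * ω * Complex.I) ^ (-(β : ℂ)) := by
  have h1 := integral_rpow_mul_cexp hβ (z := (ε : ℂ) + 2 * Real.pi * ω * Complex.I)
    (by simpa using hε)
  have hG : (Real.Gamma β : ℂ) ≠ 0 := by exact_mod_cast (Real.Gamma_pos_of_pos hβ).ne'
  rw [Real.fourier_real_eq_integral_exp_smul, ← mul_right_inj' hG, ← h1, ← integral_const_mul,
    ← integral_indicator measurableSet_Ioi]
  congr 1
  ext t
  by_cases h : t ∈ Ioi (0 : ℝ)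
  · simp only [dampedKernel, indicator_of_mem h, smul_eq_mul]
    push_cast
    field_simp
    rw [mul_assoc, mul_comm, mul_assoc, ← Complex.exp_add]
    congr 2
    ring
  · simp [dampedKernel, indicator_of_notMem h]

/-- The Fourier transform of the reflection of a real function. -/
theorem fourier_comp_neg_ofReal (K : ℝ → ℝ) (ω : ℝ) :
    𝓕 (fun t => (K (-t) : ℂ)) ω = conj (𝓕 (fun t => (K t : ℂ)) ω) := by
  rw [Real.fourier_real_eq_integral_exp_smul, Real.fourier_real_eq_integral_exp_smul,
    ← integral_conj, ← integral_neg_eq_self]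
  congr 1
  ext t
  simp [← Complex.exp_conj, Complex.conj_ofNat]

/-! ### Parseval's identity for convolutions -/

/-- Fourier inversion is applied to `g` only, so `f` may be any integrable function; it will be a
convolution with a singular kernel. -/
theorem integral_mul_conj_eq_integral_fourier {f g : ℝ → ℂ} (hf : Integrable f)
    (hg : Integrable g) (hgc : Continuous g) (hg' : Integrable (𝓕 g)) :
    ∫ x, f x * conj (g x) = ∫ ω, 𝓕 f ω * conj (𝓕 g ω) := by
  have h := VectorFourier.integral_sesq_fourierIntegral_eq_neg_flip (innerSL ℂ)
    (L := innerₗ ℝ) Real.continuous_fourierChar continuous_inner hf hg'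
  have e : VectorFourier.fourierIntegral Real.fourierChar volume (-(innerₗ ℝ).flip) (𝓕 g) = g := by
    have := hgc.fourierInv_fourier_eq hg hg'
    conv_rhs => rw [← this]
    ext x
    rw [Real.fourierInv_eq]
    simp [VectorFourier.fourierIntegral]
  rw [e] at h
  have h' := congrArg conj h
  rw [← integral_conj, ← integral_conj] at h'
  simp only [innerSL_apply_apply, RCLike.inner_apply, map_mul, Complex.conj_conj] at h'
  simp only [mul_comm (conj _)] at h'
  exact h'.symm

theorem ofReal_convolution (K f : ℝ → ℝ) (x : ℝ) :
    (((K ⋆[ContinuousLinearMap.mul ℝ ℝ] f) x : ℝ) : ℂ)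
      = ((fun t => (K t : ℂ)) ⋆[ContinuousLinearMap.mul ℂ ℂ] fun t => (f t : ℂ)) x := by
  simp only [convolution_def, ContinuousLinearMap.mul_apply']
  rw [← integral_complex_ofReal]
  simp

theorem fourier_convolution_ofReal {K f : ℝ → ℝ} (hK : Integrable K) (hf : Integrable f) (ω : ℝ) :
    𝓕 (fun x => (((K ⋆[ContinuousLinearMap.mul ℝ ℝ] f) x : ℝ) : ℂ)) ω
      = 𝓕 (fun x => (K x : ℂ)) ω * 𝓕 (fun x => (f x : ℂ)) ω := by
  simp only [ofReal_convolution]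
  exact Real.fourier_mul_convolution_eq hK.ofReal hf.ofReal ω

theorem integrable_fourier_mul {K : ℝ → ℝ} (hK : Integrable K) {g : ℝ → ℂ} (hg : Integrable g) :
    Integrable fun ω => 𝓕 (fun x => (K x : ℂ)) ω * g ω := by
  have hc : Continuous (𝓕 (fun x => (K x : ℂ))) :=
    VectorFourier.fourierIntegral_continuous Real.continuous_fourierChar
      (by exact continuous_inner) hK.ofReal
  exact hg.bdd_mul (c := ∫ x, ‖(K x : ℂ)‖) hc.aestronglyMeasurable (ae_of_all _ fun ω =>
    VectorFourier.norm_fourierIntegral_le_integral_norm _ _ _ _ _)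

theorem integrable_norm_fourier_sq {f : ℝ → ℂ} (hf' : Integrable (𝓕 f)) :
    Integrable fun ω => ‖𝓕 f ω‖ ^ 2 := by
  have := hf'.norm.mul_bdd (c := ∫ x, ‖f x‖) hf'.norm.aestronglyMeasurable
    (ae_of_all _ fun ω => by
      rw [norm_norm]
      exact VectorFourier.norm_fourierIntegral_le_integral_norm _ _ _ _ _)
  exact this.congr (ae_of_all _ fun ω => (sq _).symm)

section

variable {K K' f : ℝ → ℝ}

theorem integral_convolution_mul (hK : Integrable K) (hf : Integrable f) (hfc : Continuous f)
    (hf' : Integrable (𝓕 fun x => (f x : ℂ))) :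
    ∫ x, (K ⋆[ContinuousLinearMap.mul ℝ ℝ] f) x * f x
      = ∫ ω, (𝓕 (fun x => (K x : ℂ)) ω).re * ‖𝓕 (fun x => (f x : ℂ)) ω‖ ^ 2 := by
  have h := integral_mul_conj_eq_integral_fourier (f := fun x =>
    (((K ⋆[ContinuousLinearMap.mul ℝ ℝ] f) x : ℝ) : ℂ)) (g := fun x => (f x : ℂ))
    (hK.integrable_convolution _ hf).ofReal hf.ofReal (by fun_prop) hf'
  have h2 := congrArg Complex.re h
  have e1 : ∫ x, (((K ⋆[ContinuousLinearMap.mul ℝ ℝ] f) x : ℝ) : ℂ) * conj (f x : ℂ)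
      = ((∫ x, (K ⋆[ContinuousLinearMap.mul ℝ ℝ] f) x * f x : ℝ) : ℂ) := by
    rw [← integral_complex_ofReal]
    simp
  rw [e1, Complex.ofReal_re] at h2
  have hi : Integrable fun ω =>
      𝓕 (fun x => (K x : ℂ)) ω * ((‖𝓕 (fun x => (f x : ℂ)) ω‖ ^ 2 : ℝ) : ℂ) := by
    refine integrable_fourier_mul hK ?_
    exact (integrable_norm_fourier_sq hf').ofReal
  rw [h2]
  have e2 : ∀ ω, 𝓕 (fun x => (((K ⋆[ContinuousLinearMap.mul ℝ ℝ] f) x : ℝ) : ℂ)) ω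
      * conj (𝓕 (fun x => (f x : ℂ)) ω)
      = 𝓕 (fun x => (K x : ℂ)) ω * ((‖𝓕 (fun x => (f x : ℂ)) ω‖ ^ 2 : ℝ) : ℂ) := by
    intro ω
    rw [fourier_convolution_ofReal hK hf, mul_assoc, Complex.mul_conj, Complex.normSq_eq_norm_sq]
  simp only [e2]
  rw [← RCLike.re_eq_complex_re, ← integral_re hi]
  simp only [RCLike.re_eq_complex_re, Complex.re_mul_ofReal]

theorem integral_convolution_mul_convolution (hK : Integrable K) (hK' : Integrable K')
    (hf : Integrable f) (hfc : Continuous f) (hfs : HasCompactSupport f)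
    (hf' : Integrable (𝓕 fun x => (f x : ℂ))) :
    ∫ x, (K ⋆[ContinuousLinearMap.mul ℝ ℝ] f) x * (K' ⋆[ContinuousLinearMap.mul ℝ ℝ] f) x
      = ∫ ω, (𝓕 (fun x => (K x : ℂ)) ω * conj (𝓕 (fun x => (K' x : ℂ)) ω)).re
        * ‖𝓕 (fun x => (f x : ℂ)) ω‖ ^ 2 := by
  have hF : (𝓕 (fun x => (((K' ⋆[ContinuousLinearMap.mul ℝ ℝ] f) x : ℝ) : ℂ)))
      = fun ω => 𝓕 (fun x => (K' x : ℂ)) ω * 𝓕 (fun x => (f x : ℂ)) ω :=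
    funext fun ω => fourier_convolution_ofReal hK' hf ω
  have hc : Continuous (K' ⋆[ContinuousLinearMap.mul ℝ ℝ] f) :=
    hfs.continuous_convolution_right _ hK'.locallyIntegrable hfc
  have h := integral_mul_conj_eq_integral_fourier (f := fun x =>
    (((K ⋆[ContinuousLinearMap.mul ℝ ℝ] f) x : ℝ) : ℂ))
    (g := fun x => (((K' ⋆[ContinuousLinearMap.mul ℝ ℝ] f) x : ℝ) : ℂ))
    (hK.integrable_convolution _ hf).ofReal (hK'.integrable_convolution _ hf).ofReal
    (Complex.continuous_ofReal.comp hc) (by rw [hF]; exact integrable_fourier_mul hK' hf')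
  have h2 := congrArg Complex.re h
  have e1 : ∫ x, (((K ⋆[ContinuousLinearMap.mul ℝ ℝ] f) x : ℝ) : ℂ)
        * conj (((K' ⋆[ContinuousLinearMap.mul ℝ ℝ] f) x : ℝ) : ℂ)
      = ((∫ x, (K ⋆[ContinuousLinearMap.mul ℝ ℝ] f) x
        * (K' ⋆[ContinuousLinearMap.mul ℝ ℝ] f) x : ℝ) : ℂ) := by
    rw [← integral_complex_ofReal]
    simp
  rw [e1, Complex.ofReal_re] at h2
  have hb : Integrable fun ω => ((‖𝓕 (fun x => (f x : ℂ)) ω‖ ^ 2 : ℝ) : ℂ) := by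
    exact (integrable_norm_fourier_sq hf').ofReal
  -- The conjugate of the transform of `K'` is the transform of its reflection, so integrability of
  -- the triple product follows from two uses of `integrable_fourier_mul`.
  have hK'' : Integrable fun t => K' (-t) := hK'.comp_neg
  have hi := integrable_fourier_mul hK (integrable_fourier_mul hK'' hb)
  rw [h2]
  have e2 : ∀ ω, 𝓕 (fun x => (((K ⋆[ContinuousLinearMap.mul ℝ ℝ] f) x : ℝ) : ℂ)) ω
      * conj (𝓕 (fun x => (((K' ⋆[ContinuousLinearMap.mul ℝ ℝ] f) x : ℝ) : ℂ)) ω)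
      = 𝓕 (fun x => (K x : ℂ)) ω * (𝓕 (fun x => (K' (-x) : ℂ)) ω
        * ((‖𝓕 (fun x => (f x : ℂ)) ω‖ ^ 2 : ℝ) : ℂ)) := by
    intro ω
    rw [fourier_convolution_ofReal hK hf, fourier_convolution_ofReal hK' hf,
      fourier_comp_neg_ofReal, map_mul, ← Complex.normSq_eq_norm_sq, ← Complex.mul_conj]
    ring
  simp only [e2]
  rw [← RCLike.re_eq_complex_re, ← integral_re hi]
  refine integral_congr_ae (ae_of_all _ fun ω => ?_)
  simp only [fourier_comp_neg_ofReal, ← mul_assoc, RCLike.re_eq_complex_re, Complex.re_mul_ofReal]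

end

/-! ### Test functions and their Fourier transforms -/

theorem Test.eq_zero_of_notMem (φ : Test) {x : ℝ} (hx : x ∉ Ioo (0 : ℝ) 1) : φ x = 0 := by
  by_contra hne
  exact hx (φ.tsupport_subset (subset_tsupport _ hne))

/-- The derivative of a test function. -/
noncomputable def testDeriv (φ : Test) : Test where
  toFun := deriv φ
  contDiff' := φ.contDiff.deriv'
  hasCompactSupport' := φ.hasCompactSupport.deriv
  tsupport_subset' := tsupport_deriv_subset.trans φ.tsupport_subset

@[simp] theorem coe_testDeriv (φ : Test) : ⇑(testDeriv φ) = deriv φ := rfl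

theorem Test.differentiable (φ : Test) : Differentiable ℝ φ :=
  φ.contDiff.differentiable (by simp)

theorem testDeriv_add (φ ψ : Test) : testDeriv (φ + ψ) = testDeriv φ + testDeriv ψ := by
  ext x
  simp only [coe_testDeriv, FunLike.coe_add]
  exact deriv_add (φ.differentiable x) (ψ.differentiable x)

theorem testDeriv_smul (c : ℝ) (φ : Test) : testDeriv (c • φ) = c • testDeriv φ := by
  ext x
  simp only [coe_testDeriv, FunLike.coe_smul]
  exact deriv_const_smul c (φ.differentiable x)

/-- The Fourier transform of a test function. -/
noncomputable def testFourier (φ : Test) : ℝ → ℂ := 𝓕 fun x => (φ x : ℂ)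

/-- A test function as a Schwartz function. -/
noncomputable def Test.toSchwartz (φ : Test) : SchwartzMap ℝ ℂ :=
  HasCompactSupport.toSchwartzMap (f := fun x => (φ x : ℂ))
    (φ.hasCompactSupport.comp_left (g := fun r : ℝ => (r : ℂ)) Complex.ofReal_zero)
    (Complex.ofRealCLM.contDiff.comp φ.contDiff)

theorem coe_fourier_toSchwartz (φ : Test) : ⇑(𝓕 φ.toSchwartz : SchwartzMap ℝ ℂ) = testFourier φ := rfl

theorem continuous_testFourier (φ : Test) : Continuous (testFourier φ) :=
  (𝓕 φ.toSchwartz : SchwartzMap ℝ ℂ).continuous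

theorem integrable_testFourier (φ : Test) : Integrable (testFourier φ) :=
  (𝓕 φ.toSchwartz : SchwartzMap ℝ ℂ).integrable

theorem integral_norm_testFourier_sq (φ : Test) :
    ∫ ω, ‖testFourier φ ω‖ ^ 2 = ∫ x, φ x ^ 2 := by
  have := φ.toSchwartz.integral_norm_sq_fourier
  rw [coe_fourier_toSchwartz] at this
  rw [this]
  refine integral_congr_ae (ae_of_all _ fun x => ?_)
  change ‖(φ x : ℂ)‖ ^ 2 = φ x ^ 2
  simp

theorem testFourier_testDeriv (φ : Test) (ω : ℝ) :
    testFourier (testDeriv φ) ω = (2 * Real.pi * Complex.I * ω) * testFourier φ ω := by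
  have hd : deriv (fun x => (φ x : ℂ)) = fun x => ((deriv φ x : ℝ) : ℂ) := by
    ext x
    exact (φ.differentiable x).hasDerivAt.ofReal_comp.deriv
  have h := Real.fourier_deriv (f := fun x => (φ x : ℂ)) (test_integrable' φ).ofReal
    (fun x => (φ.differentiable x).hasDerivAt.ofReal_comp.differentiableAt)
    (by rw [hd]; exact (test_integrable' (testDeriv φ)).ofReal)
  rw [hd] at h
  exact congrFun h ω

theorem norm_testFourier_testDeriv (φ : Test) (ω : ℝ) :
    ‖testFourier (testDeriv φ) ω‖ = 2 * Real.pi * |ω| * ‖testFourier φ ω‖ := by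
  simp [testFourier_testDeriv, abs_of_pos Real.pi_pos]

theorem integrable_norm_testFourier_sq (φ : Test) : Integrable fun ω => ‖testFourier φ ω‖ ^ 2 :=
  integrable_norm_fourier_sq (integrable_testFourier φ)

/-! ### Homogeneous Sobolev energies and the Poincaré inequality -/

theorem rpow_two_mul_le {s : ℝ} (hs0 : 0 ≤ s) (hs1 : s ≤ 1) {a : ℝ} (ha : 0 ≤ a) :
    a ^ (2 * s) ≤ 1 + a ^ 2 := by
  rcases le_total a 1 with h | h
  · have := Real.rpow_le_one ha h (by linarith : 0 ≤ 2 * s)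
    nlinarith [sq_nonneg a]
  · have := Real.rpow_le_rpow_of_exponent_le h (by linarith : 2 * s ≤ 2)
    rw [Real.rpow_two] at this
    linarith

/-- The square of the homogeneous Sobolev seminorm of a test function. -/
noncomputable def energy (s : ℝ) (φ : Test) : ℝ := ∫ ω, |ω| ^ (2 * s) * ‖testFourier φ ω‖ ^ 2

theorem energy_nonneg (s : ℝ) (φ : Test) : 0 ≤ energy s φ :=
  integral_nonneg fun _ => by positivity

theorem integrable_sq_mul_norm_testFourier_sq (φ : Test) :
    Integrable fun ω => |ω| ^ 2 * ‖testFourier φ ω‖ ^ 2 := by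
  refine ((integrable_norm_testFourier_sq (testDeriv φ)).const_mul (1 / (2 * Real.pi) ^ 2)).congr
    (ae_of_all _ fun ω => ?_)
  simp only [norm_testFourier_testDeriv]
  field_simp [Real.pi_pos.ne']

theorem integrable_energy {s : ℝ} (hs0 : 0 ≤ s) (hs1 : s ≤ 1) (φ : Test) :
    Integrable fun ω => |ω| ^ (2 * s) * ‖testFourier φ ω‖ ^ 2 := by
  refine ((integrable_norm_testFourier_sq φ).add
    (integrable_sq_mul_norm_testFourier_sq φ)).mono' ?_ (ae_of_all _ fun ω => ?_)
  · have := (continuous_testFourier φ).measurable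
    exact Measurable.aestronglyMeasurable (by fun_prop)
  · rw [Real.norm_of_nonneg (by positivity), Pi.add_apply]
    have := mul_le_mul_of_nonneg_right (rpow_two_mul_le hs0 hs1 (abs_nonneg ω))
      (sq_nonneg ‖testFourier φ ω‖)
    linarith

theorem energy_le {s : ℝ} (hs0 : 0 ≤ s) (hs1 : s ≤ 1) (φ : Test) :
    energy s φ ≤ (∫ x, φ x ^ 2) + energy 1 φ := by
  rw [← integral_norm_testFourier_sq, energy, energy,
    ← integral_add (integrable_norm_testFourier_sq φ) (integrable_energy zero_le_one le_rfl φ)]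
  refine integral_mono (integrable_energy hs0 hs1 φ) ((integrable_norm_testFourier_sq φ).add
    (integrable_energy zero_le_one le_rfl φ)) fun ω => ?_
  have := mul_le_mul_of_nonneg_right (rpow_two_mul_le hs0 hs1 (abs_nonneg ω))
    (sq_nonneg ‖testFourier φ ω‖)
  simp only [mul_one, Real.rpow_two]
  linarith

theorem integral_testDeriv_sq (φ : Test) :
    ∫ x, testDeriv φ x ^ 2 = (2 * Real.pi) ^ 2 * energy 1 φ := by
  rw [← integral_norm_testFourier_sq, energy, ← integral_const_mul]
  refine integral_congr_ae (ae_of_all _ fun ω => ?_)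
  simp only [norm_testFourier_testDeriv, mul_one, Real.rpow_two]
  ring

theorem Test.integrable_sq (φ : Test) : Integrable fun x => φ x ^ 2 := by
  refine Continuous.integrable_of_hasCompactSupport (by fun_prop) ?_
  exact φ.hasCompactSupport.comp_left (g := fun r : ℝ => r ^ 2) (by norm_num)

theorem norm_testFourier_sq_le (φ : Test) (ω : ℝ) :
    ‖testFourier φ ω‖ ^ 2 ≤ ∫ x, φ x ^ 2 := by
  have h1 : ‖testFourier φ ω‖ ≤ ∫ x, ‖(φ x : ℂ)‖ :=
    VectorFourier.norm_fourierIntegral_le_integral_norm _ _ _ _ _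
  have h2 : ∫ x, ‖(φ x : ℂ)‖ = ∫ x in Ioo (0 : ℝ) 1, |φ x| := by
    rw [← integral_indicator measurableSet_Ioo]
    congr 1
    ext x
    by_cases hx : x ∈ Ioo (0 : ℝ) 1
    · simp [indicator_of_mem hx]
    · simp [indicator_of_notMem hx, φ.eq_zero_of_notMem hx]
  have hi : IntegrableOn (fun x => |φ x|) (Ioo (0 : ℝ) 1) := (test_integrable' φ).abs.integrableOn
  have hi2 : IntegrableOn (fun x => φ x ^ 2) (Ioo (0 : ℝ) 1) := φ.integrable_sq.integrableOn
  set m := ∫ x in Ioo (0 : ℝ) 1, |φ x| with hm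
  -- On an interval of length one, nonnegativity of this variance is the Cauchy–Schwarz bound of the
  -- L¹ norm by the L² norm.
  have h3 : 0 ≤ ∫ x in Ioo (0 : ℝ) 1, (|φ x| - m) ^ 2 := integral_nonneg fun _ => sq_nonneg _
  have h4 : ∫ x in Ioo (0 : ℝ) 1, (|φ x| - m) ^ 2
      = (∫ x in Ioo (0 : ℝ) 1, φ x ^ 2) - m ^ 2 := by
    have e : ∀ x, (|φ x| - m) ^ 2 = φ x ^ 2 - 2 * m * |φ x| + m ^ 2 := fun x => by
      rw [sub_sq, sq_abs]; ring
    simp only [e]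
    have hs : IntegrableOn (fun x => φ x ^ 2 - 2 * m * |φ x|) (Ioo (0 : ℝ) 1) :=
      hi2.sub (hi.const_mul _)
    rw [integral_add hs (integrable_const _), integral_sub hi2 (hi.const_mul _), integral_const_mul, ← hm]
    simp
    ring
  have h5 : ∫ x in Ioo (0 : ℝ) 1, φ x ^ 2 ≤ ∫ x, φ x ^ 2 :=
    setIntegral_le_integral φ.integrable_sq (ae_of_all _ fun _ => sq_nonneg _)
  rw [h2] at h1
  have h6 : ‖testFourier φ ω‖ ^ 2 ≤ m ^ 2 := pow_le_pow_left₀ (norm_nonneg _) h1 2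
  linarith

/-- The Poincaré inequality for the homogeneous Sobolev seminorms. -/
theorem integral_sq_le_energy {s : ℝ} (hs0 : 0 ≤ s) (hs1 : s ≤ 1) (φ : Test) :
    ∫ x, φ x ^ 2 ≤ 2 * 4 ^ (2 * s) * energy s φ := by
  set A := ∫ x, φ x ^ 2 with hA
  have hA0 : 0 ≤ A := integral_nonneg fun _ => sq_nonneg _
  -- The low-frequency window has length 1/2 and the squared transform is at most `A`, so it
  -- contributes at most `A / 2`, which the left side absorbs. Outside the window (4|ω|)^(2s) ≥ 1.
  have hind : Integrable ((Icc (-(1 / 4) : ℝ) (1 / 4)).indicator fun _ => A) :=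
    (integrable_indicator_iff measurableSet_Icc).2 (by simp)
  have hE := (integrable_energy hs0 hs1 φ).const_mul ((4 : ℝ) ^ (2 * s))
  have h1 : A ≤ ∫ ω, ((Icc (-(1 / 4) : ℝ) (1 / 4)).indicator (fun _ => A) ω
      + 4 ^ (2 * s) * (|ω| ^ (2 * s) * ‖testFourier φ ω‖ ^ 2)) := by
    conv_lhs => rw [hA, ← integral_norm_testFourier_sq]
    refine integral_mono (integrable_norm_testFourier_sq φ) (hind.add hE) fun ω => ?_
    by_cases h : ω ∈ Icc (-(1 / 4) : ℝ) (1 / 4)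
    · simp only [indicator_of_mem h]
      have := norm_testFourier_sq_le φ ω
      have h' : (0 : ℝ) ≤ 4 ^ (2 * s) * (|ω| ^ (2 * s) * ‖testFourier φ ω‖ ^ 2) := by positivity
      linarith
    · simp only [indicator_of_notMem h, zero_add]
      rw [← mul_assoc, ← Real.mul_rpow (by norm_num) (abs_nonneg _)]
      refine le_mul_of_one_le_left (sq_nonneg _) (Real.one_le_rpow ?_ (by linarith))
      have : ¬ |ω| ≤ 1 / 4 := fun h' => h (abs_le.1 h')
      linarith
  rw [integral_add hind hE, integral_indicator measurableSet_Icc, integral_const_mul] at h1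
  have h2 : ∫ _ in Icc (-(1 / 4) : ℝ) (1 / 4), A = A / 2 := by
    simp; ring
  rw [h2] at h1
  change A ≤ A / 2 + 4 ^ (2 * s) * energy s φ at h1
  linarith

theorem sobolevSeminorm_sq (s : ℝ) (hs0 : 0 ≤ s) (hs1 : s ≤ 1) (φ : Test) :
    sobolevSeminorm s φ ^ 2 = ENNReal.ofReal (energy s φ) := by
  rw [sobolevSeminorm, energy, ofReal_integral_eq_lintegral_ofReal (integrable_energy hs0 hs1 φ)
    (ae_of_all _ fun _ => by positivity), ← ENNReal.rpow_natCast]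
  rw [eLpNorm_eq_lintegral_rpow_enorm_toReal (by norm_num) (by norm_num), ← ENNReal.rpow_mul]
  norm_num
  refine lintegral_congr fun ω => ?_
  rw [← enorm_mul, ← ofReal_norm, ← ENNReal.ofReal_pow (norm_nonneg _)]
  congr 1
  rw [norm_mul, mul_pow, Complex.norm_real, Real.norm_of_nonneg (by positivity), mul_comm 2 s,
    Real.rpow_mul (abs_nonneg _), Real.rpow_two]
  rfl

notation K:67 " ⋆ᵣ " f:68 => convolution K f (ContinuousLinearMap.mul ℝ ℝ) volume

/-! ### Convolution of kernels with test functions -/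

theorem Test.exists_bound (g : Test) : ∃ C, 0 ≤ C ∧ ∀ x, ‖g x‖ ≤ C := by
  obtain ⟨C, hC⟩ := g.continuous.bounded_above_of_compact_support g.hasCompactSupport
  exact ⟨C, (norm_nonneg _).trans (hC 0), hC⟩

theorem continuous_conv {K : ℝ → ℝ} (hK : Integrable K) (g : Test) : Continuous (K ⋆ᵣ g) :=
  g.hasCompactSupport.continuous_convolution_right _ hK.locallyIntegrable g.continuous

theorem norm_conv_le {K : ℝ → ℝ} (hK : Integrable K) {g : ℝ → ℝ} {C : ℝ} (hC : ∀ x, ‖g x‖ ≤ C)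
    (x : ℝ) : ‖(K ⋆ᵣ g) x‖ ≤ C * ∫ t, ‖K t‖ := by
  rw [convolution_def, ← integral_const_mul]
  refine norm_integral_le_of_norm_le (hK.norm.const_mul C) (ae_of_all _ fun t => ?_)
  rw [ContinuousLinearMap.mul_apply', norm_mul, mul_comm]
  gcongr
  exact hC _

/-- `Kn` are integrable kernels that converge to `K` on `(-1, 1)` and are dominated by `K`
there. -/
structure KernelApprox (Kn : ℕ → ℝ → ℝ) (K : ℝ → ℝ) : Prop where
  integrable_lim : Integrable K
  integrable : ∀ n, Integrable (Kn n)
  norm_le : ∀ n t, |t| < 1 → ‖Kn n t‖ ≤ ‖K t‖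
  tendsto : ∀ t, |t| < 1 → Tendsto (fun n => Kn n t) atTop (𝓝 (K t))

namespace KernelApprox

variable {Kn Kn' : ℕ → ℝ → ℝ} {K K' : ℝ → ℝ}

theorem comp_neg (h : KernelApprox Kn K) :
    KernelApprox (fun n t => Kn n (-t)) (fun t => K (-t)) where
  integrable_lim := h.integrable_lim.comp_neg
  integrable n := (h.integrable n).comp_neg
  norm_le n t ht := h.norm_le n (-t) (by rwa [abs_neg])
  tendsto t ht := h.tendsto (-t) (by rwa [abs_neg])

/-- Only the values of a kernel on (-1, 1) matter for convolutions observed on the unit interval.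
That is why `KernelApprox` compares kernels only there. -/
theorem test_sub_eq_zero (g : Test) {x t : ℝ} (hx : x ∈ Ioo (0 : ℝ) 1) (ht : ¬ |t| < 1) :
    g (x - t) = 0 := by
  refine g.eq_zero_of_notMem fun h => ht ?_
  rw [abs_lt]
  constructor <;> linarith [h.1, h.2, hx.1, hx.2]

theorem norm_integrand_le (h : KernelApprox Kn K) {g : Test} {C : ℝ} (hC : ∀ x, ‖g x‖ ≤ C)
    {x : ℝ} (hx : x ∈ Ioo (0 : ℝ) 1) (n : ℕ) (t : ℝ) :
    ‖Kn n t * g (x - t)‖ ≤ C * ‖K t‖ := by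
  by_cases ht : |t| < 1
  · rw [norm_mul, mul_comm]
    have := h.norm_le n t ht
    have hC0 : 0 ≤ C := (norm_nonneg _).trans (hC 0)
    gcongr
    exact hC _
  · rw [test_sub_eq_zero g hx ht, mul_zero, norm_zero]
    have := (norm_nonneg _).trans (hC 0)
    positivity

theorem norm_conv_le (h : KernelApprox Kn K) {g : Test} {C : ℝ} (hC : ∀ x, ‖g x‖ ≤ C)
    {x : ℝ} (hx : x ∈ Ioo (0 : ℝ) 1) (n : ℕ) :
    ‖(Kn n ⋆ᵣ g) x‖ ≤ C * ∫ t, ‖K t‖ := by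
  rw [convolution_def, ← integral_const_mul]
  exact norm_integral_le_of_norm_le (h.integrable_lim.norm.const_mul C)
    (ae_of_all _ fun t => h.norm_integrand_le hC hx n t)

theorem tendsto_conv (h : KernelApprox Kn K) (g : Test) {x : ℝ} (hx : x ∈ Ioo (0 : ℝ) 1) :
    Tendsto (fun n => (Kn n ⋆ᵣ g) x) atTop (𝓝 ((K ⋆ᵣ g) x)) := by
  obtain ⟨C, hC0, hC⟩ := g.exists_bound
  simp only [convolution_def, ContinuousLinearMap.mul_apply']
  refine tendsto_integral_of_dominated_convergence (fun t => C * ‖K t‖)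
    (fun n => ?_) (h.integrable_lim.norm.const_mul C)
    (fun n => ae_of_all _ fun t => h.norm_integrand_le hC hx n t) (ae_of_all _ fun t => ?_)
  · exact (h.integrable n).aestronglyMeasurable.mul
      (g.continuous.comp (continuous_const.sub continuous_id)).aestronglyMeasurable
  · by_cases ht : |t| < 1
    · exact (h.tendsto t ht).mul_const _
    · simp only [test_sub_eq_zero g hx ht, mul_zero]
      exact tendsto_const_nhds

/-- Dominated convergence twice: inside each convolution with bound C‖K‖, then over the unit
interval with a constant bound. -/
theorem tendsto_integral_mul (h : KernelApprox Kn K) (h' : KernelApprox Kn' K') (g : Test) :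
    Tendsto (fun n => ∫ x in Ioo (0 : ℝ) 1, (Kn n ⋆ᵣ g) x * (Kn' n ⋆ᵣ g) x) atTop
      (𝓝 (∫ x in Ioo (0 : ℝ) 1, (K ⋆ᵣ g) x * (K' ⋆ᵣ g) x)) := by
  obtain ⟨C, hC0, hC⟩ := g.exists_bound
  refine tendsto_integral_of_dominated_convergence
    (fun _ => (C * ∫ t, ‖K t‖) * (C * ∫ t, ‖K' t‖)) (fun n => ?_) (integrable_const _)
    (fun n => ?_) ?_
  · exact ((continuous_conv (h.integrable n) g).mul
      (continuous_conv (h'.integrable n) g)).aestronglyMeasurable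
  · filter_upwards [ae_restrict_mem measurableSet_Ioo] with x hx
    rw [norm_mul]
    exact mul_le_mul (h.norm_conv_le hC hx n) (h'.norm_conv_le hC hx n) (norm_nonneg _)
      (mul_nonneg hC0 (integral_nonneg fun _ => norm_nonneg _))
  · filter_upwards [ae_restrict_mem measurableSet_Ioo] with x hx
    exact (h.tendsto_conv g hx).mul (h'.tendsto_conv g hx)

theorem tendsto_integral_mul_test (h : KernelApprox Kn K) (g : Test) :
    Tendsto (fun n => ∫ x, (Kn n ⋆ᵣ g) x * g x) atTop
      (𝓝 (∫ x in Ioo (0 : ℝ) 1, (K ⋆ᵣ g) x * g x)) := by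
  have e (n : ℕ) : ∫ x, (Kn n ⋆ᵣ g) x * g x = ∫ x in Ioo (0 : ℝ) 1, (Kn n ⋆ᵣ g) x * g x := by
    refine (setIntegral_eq_integral_of_forall_compl_eq_zero fun x hx => ?_).symm
    rw [g.eq_zero_of_notMem hx, mul_zero]
  simp only [e]
  obtain ⟨C, hC0, hC⟩ := g.exists_bound
  refine tendsto_integral_of_dominated_convergence
    (fun _ => (C * ∫ t, ‖K t‖) * C) (fun n => ?_) (integrable_const _)
    (fun n => ?_) ?_
  · exact ((continuous_conv (h.integrable n) g).mul g.continuous).aestronglyMeasurable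
  · filter_upwards [ae_restrict_mem measurableSet_Ioo] with x hx
    rw [norm_mul]
    exact mul_le_mul (h.norm_conv_le hC hx n) (hC x) (norm_nonneg _)
      (mul_nonneg hC0 (integral_nonneg fun _ => norm_nonneg _))
  · filter_upwards [ae_restrict_mem measurableSet_Ioo] with x hx
    exact (h.tendsto_conv g hx).mul_const _

end KernelApprox

/-- The damping parameters used to approximate the kernel of the fractional integral. -/
noncomputable def damping (n : ℕ) : ℝ := 1 / ((n : ℝ) + 1)

theorem damping_pos (n : ℕ) : 0 < damping n := by unfold damping; positivity

theorem tendsto_damping : Tendsto damping atTop (𝓝 0) :=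
  tendsto_one_div_add_atTop_nhds_zero_nat

theorem kernelApprox {β : ℝ} (hβ : 0 < β) :
    KernelApprox (fun n => dampedKernel β (damping n)) (unitKernel β) where
  integrable_lim := integrable_unitKernel hβ
  integrable n := integrable_dampedKernel hβ (damping_pos n)
  norm_le n _ ht := norm_dampedKernel_le hβ (damping_pos n) (abs_lt.1 ht).2
  tendsto _ ht := tendsto_dampedKernel β (abs_lt.1 ht).2 tendsto_damping

/-! ### The energy identities in the Fourier picture -/

/-- The point `ε + 2πiω`. -/
noncomputable def halfPlanePoint (ε ω : ℝ) : ℂ := (ε : ℂ) + 2 * Real.pi * ω * Complex.I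

theorem halfPlanePoint_re (ε ω : ℝ) : (halfPlanePoint ε ω).re = ε := by
  simp [halfPlanePoint]

theorem halfPlanePoint_im (ε ω : ℝ) : (halfPlanePoint ε ω).im = 2 * Real.pi * ω := by
  simp [halfPlanePoint]

theorem le_norm_halfPlanePoint (ε ω : ℝ) : 2 * Real.pi * |ω| ≤ ‖halfPlanePoint ε ω‖ := by
  have := Complex.abs_im_le_norm (halfPlanePoint ε ω)
  rwa [halfPlanePoint_im, abs_mul, abs_of_pos Real.two_pi_pos] at this

theorem two_pi_rpow_mul_sq {a ω : ℝ} (hω : ω ≠ 0) :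
    (2 * Real.pi * |ω|) ^ (-a) * (2 * Real.pi * |ω|) ^ 2
      = (2 * Real.pi) ^ (2 - a) * |ω| ^ (2 * (1 - a / 2)) := by
  have h : 0 < 2 * Real.pi * |ω| := by positivity
  rw [← Real.rpow_two, ← Real.rpow_add h, Real.mul_rpow (by positivity) (abs_nonneg _)]
  ring_nf

theorem ae_ne_zero : ∀ᵐ ω : ℝ, ω ≠ 0 := by
  simp [ae_iff, measure_singleton]

/-- The modulus of ε + 2πiω is smallest at ε = 0, so its negative powers are largest there. The
factor 2π|ω| of the derivative turns order -a/2 into order 1 - a/2. -/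
theorem norm_rpow_mul_testFourier_le {a : ℝ} (ha0 : 0 ≤ a) (φ : Test) {ε ω : ℝ} (hω : ω ≠ 0) :
    ‖halfPlanePoint ε ω‖ ^ (-a) * ‖testFourier (testDeriv φ) ω‖ ^ 2
      ≤ (2 * Real.pi) ^ (2 - a) * (|ω| ^ (2 * (1 - a / 2)) * ‖testFourier φ ω‖ ^ 2) := by
  have h : 0 < 2 * Real.pi * |ω| := by positivity
  rw [norm_testFourier_testDeriv, mul_pow, ← mul_assoc, ← mul_assoc, ← two_pi_rpow_mul_sq hω]
  gcongr ?_ * _ * _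
  exact Real.rpow_le_rpow_of_nonpos h (le_norm_halfPlanePoint ε ω) (by linarith)

theorem measurable_norm_rpow_mul (a ε : ℝ) (φ : Test) :
    AEStronglyMeasurable (fun ω : ℝ => ‖halfPlanePoint ε ω‖ ^ (-a)
      * ‖testFourier (testDeriv φ) ω‖ ^ 2) := by
  have := (continuous_testFourier (testDeriv φ)).measurable
  have h2 : Measurable (halfPlanePoint ε) := by unfold halfPlanePoint; fun_prop
  exact Measurable.aestronglyMeasurable (by fun_prop)

theorem integrable_norm_rpow_mul {a : ℝ} (ha0 : 0 ≤ a) (ha2 : a ≤ 2) (ε : ℝ) (φ : Test) :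
    Integrable fun ω : ℝ => ‖halfPlanePoint ε ω‖ ^ (-a) * ‖testFourier (testDeriv φ) ω‖ ^ 2 := by
  refine ((integrable_energy (s := 1 - a / 2) (by linarith) (by linarith) φ).const_mul
    ((2 * Real.pi) ^ (2 - a))).mono' (measurable_norm_rpow_mul a ε φ) ?_
  filter_upwards [ae_ne_zero] with ω hω
  rw [Real.norm_of_nonneg (by positivity)]
  exact norm_rpow_mul_testFourier_le ha0 φ hω

theorem integral_norm_rpow_mul_le {a : ℝ} (ha0 : 0 ≤ a) (ha2 : a ≤ 2) (ε : ℝ) (φ : Test) :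
    ∫ ω : ℝ, ‖halfPlanePoint ε ω‖ ^ (-a) * ‖testFourier (testDeriv φ) ω‖ ^ 2
      ≤ (2 * Real.pi) ^ (2 - a) * energy (1 - a / 2) φ := by
  rw [energy, ← integral_const_mul]
  refine integral_mono_ae (integrable_norm_rpow_mul ha0 ha2 ε φ)
    ((integrable_energy (s := 1 - a / 2) (by linarith) (by linarith) φ).const_mul _) ?_
  filter_upwards [ae_ne_zero] with ω hω
  exact norm_rpow_mul_testFourier_le ha0 φ hω

theorem tendsto_integral_norm_rpow_mul {a : ℝ} (ha0 : 0 ≤ a) (ha2 : a ≤ 2) (φ : Test) :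
    Tendsto (fun n => ∫ ω : ℝ, ‖halfPlanePoint (damping n) ω‖ ^ (-a)
      * ‖testFourier (testDeriv φ) ω‖ ^ 2) atTop
      (𝓝 ((2 * Real.pi) ^ (2 - a) * energy (1 - a / 2) φ)) := by
  rw [energy, ← integral_const_mul]
  have hi := (integrable_energy (s := 1 - a / 2) (by linarith) (by linarith) φ).const_mul
    ((2 * Real.pi) ^ (2 - a))
  refine tendsto_integral_of_dominated_convergence _ (fun n => measurable_norm_rpow_mul a _ φ) hi
    (fun n => ?_) ?_
  · filter_upwards [ae_ne_zero] with ω hω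
    rw [Real.norm_of_nonneg (by positivity)]
    exact norm_rpow_mul_testFourier_le ha0 φ hω
  · filter_upwards [ae_ne_zero] with ω hω
    have h0 : ‖halfPlanePoint 0 ω‖ = 2 * Real.pi * |ω| := by
      simp [halfPlanePoint, abs_of_pos Real.pi_pos]
    have h1 : Tendsto (fun n => ‖halfPlanePoint (damping n) ω‖) atTop
        (𝓝 (2 * Real.pi * |ω|)) := by
      rw [← h0]
      have hc : Continuous fun ε => ‖halfPlanePoint ε ω‖ := by unfold halfPlanePoint; fun_prop
      exact (hc.tendsto 0).comp tendsto_damping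
    have h2 := (h1.rpow_const (p := -a) (Or.inl (by positivity))).mul_const
      (‖testFourier (testDeriv φ) ω‖ ^ 2)
    rw [← mul_assoc, ← two_pi_rpow_mul_sq hω, mul_assoc, ← mul_pow, ← norm_testFourier_testDeriv]
    exact h2

section

variable {β : ℝ}

theorem fourier_dampedKernel' (hβ : 0 < β) {ε : ℝ} (hε : 0 < ε) (ω : ℝ) :
    𝓕 (fun t => (dampedKernel β ε t : ℂ)) ω = halfPlanePoint ε ω ^ (-(β : ℂ)) :=
  fourier_dampedKernel hβ hε ω

/-- The symbol of the quadratic form is the real part of the transform of `K`, bounded below since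
the argument of ε + 2πiω is at most π/2. Only that real part is prescribed, so the lemma serves the
damped kernel and its reflection alike. -/
theorem integral_conv_mul_self_ge (hβ : 0 < β) (hβ1 : β ≤ 1) {ε : ℝ} (hε : 0 < ε)
    {K : ℝ → ℝ} (hK : Integrable K)
    (hF : ∀ ω, (𝓕 (fun t => (K t : ℂ)) ω).re = (halfPlanePoint ε ω ^ (-(β : ℂ))).re) (φ : Test) :
    Real.cos (β * (Real.pi / 2)) * ∫ ω : ℝ, ‖halfPlanePoint ε ω‖ ^ (-β)
        * ‖testFourier (testDeriv φ) ω‖ ^ 2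
      ≤ ∫ x, (K ⋆ᵣ (testDeriv φ)) x * testDeriv φ x := by
  have hf := integrable_testFourier (testDeriv φ)
  rw [integral_convolution_mul hK (test_integrable' _) (testDeriv φ).continuous hf,
    ← integral_const_mul]
  refine integral_mono_of_nonneg (ae_of_all _ fun ω => ?_) ?_ (ae_of_all _ fun ω => ?_)
  · have : 0 ≤ Real.cos (β * (Real.pi / 2)) :=
      Real.cos_nonneg_of_mem_Icc ⟨by nlinarith [Real.pi_pos], by nlinarith [Real.pi_pos]⟩
    simp only [Pi.zero_apply]
    positivity
  · have hi := (integrable_fourier_mul hK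
      (integrable_norm_fourier_sq hf).ofReal).re
    refine hi.congr (ae_of_all _ fun ω => ?_)
    simp only [RCLike.re_eq_complex_re]
    exact Complex.re_mul_ofReal _ _
  · simp only [hF, ← mul_assoc]
    exact mul_le_mul_of_nonneg_right (le_re_cpow_neg (by rwa [halfPlanePoint_re]) hβ.le hβ1)
      (sq_nonneg _)

theorem setIntegral_conv_sq_le (hβ : 0 < β) (hβ1 : β ≤ 1) {ε : ℝ} (hε : 0 < ε)
    {K : ℝ → ℝ} (hK : Integrable K)
    (hF : ∀ ω, ‖𝓕 (fun t => (K t : ℂ)) ω‖ = ‖halfPlanePoint ε ω ^ (-(β : ℂ))‖) (φ : Test) :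
    ∫ x in Ioo (0 : ℝ) 1, (K ⋆ᵣ (testDeriv φ)) x * (K ⋆ᵣ (testDeriv φ)) x
      ≤ (2 * Real.pi) ^ (2 - 2 * β) * energy (1 - β) φ := by
  have hf := integrable_testFourier (testDeriv φ)
  obtain ⟨C, hC0, hC⟩ := (testDeriv φ).exists_bound
  have h1 : ∫ x in Ioo (0 : ℝ) 1, (K ⋆ᵣ (testDeriv φ)) x * (K ⋆ᵣ (testDeriv φ)) x
      ≤ ∫ x, (K ⋆ᵣ (testDeriv φ)) x * (K ⋆ᵣ (testDeriv φ)) x := by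
    refine setIntegral_le_integral ?_ (ae_of_all _ fun x => mul_self_nonneg _)
    exact (hK.integrable_convolution _ (test_integrable' _)).mul_bdd
      (continuous_conv hK _).aestronglyMeasurable (ae_of_all _ fun x => norm_conv_le hK hC x)
  refine h1.trans ?_
  rw [integral_convolution_mul_convolution hK hK (test_integrable' _) (testDeriv φ).continuous
    (testDeriv φ).hasCompactSupport hf]
  have h2 := integral_norm_rpow_mul_le (a := 2 * β) (by linarith) (by linarith) ε φ
  rw [mul_div_cancel_left₀ _ two_ne_zero] at h2
  refine le_trans (le_of_eq ?_) h2
  refine integral_congr_ae (ae_of_all _ fun ω => ?_)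
  have hz : 0 < (halfPlanePoint ε ω).re := by rwa [halfPlanePoint_re]
  have hz' : 0 < ‖halfPlanePoint ε ω‖ := hz.trans_le (Complex.re_le_norm _)
  simp only [Complex.mul_conj, Complex.ofReal_re, Complex.normSq_eq_norm_sq, hF,
    norm_cpow_neg_ofReal hz]
  rw [← Real.rpow_two, ← Real.rpow_mul hz'.le]
  ring_nf
  rfl

/-- The left convolution vanishes for x ≤ 0 and the reflected one for x ≥ 1, so the product lives on
the unit interval and Parseval on the line applies without loss. Reflection and the conjugate in
Parseval cancel, so the two symbols multiply to z^(-2β) with z = ε + 2πiω. The condition β ≤ 1/2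
keeps 2β within the range of `le_re_cpow_neg`. -/
theorem integral_conv_mul_conv_neg_ge (hβ : 0 < β) (hβ1 : β ≤ 1 / 2) {ε : ℝ} (hε : 0 < ε)
    (φ : Test) :
    Real.cos (β * Real.pi) * ∫ ω : ℝ, ‖halfPlanePoint ε ω‖ ^ (-(2 * β))
        * ‖testFourier (testDeriv φ) ω‖ ^ 2
      ≤ ∫ x in Ioo (0 : ℝ) 1, (dampedKernel β ε ⋆ᵣ (testDeriv φ)) x
        * ((fun t => dampedKernel β ε (-t)) ⋆ᵣ (testDeriv φ)) x := by
  have hf := integrable_testFourier (testDeriv φ)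
  have hK := integrable_dampedKernel hβ hε
  have hK' : Integrable fun t => dampedKernel β ε (-t) := hK.comp_neg
  have hset : ∫ x in Ioo (0 : ℝ) 1, (dampedKernel β ε ⋆ᵣ (testDeriv φ)) x
        * ((fun t => dampedKernel β ε (-t)) ⋆ᵣ (testDeriv φ)) x
      = ∫ x, (dampedKernel β ε ⋆ᵣ (testDeriv φ)) x
        * ((fun t => dampedKernel β ε (-t)) ⋆ᵣ (testDeriv φ)) x := by
    refine setIntegral_eq_integral_of_forall_compl_eq_zero fun x hx => ?_
    have hx' : x ≤ 0 ∨ 1 ≤ x := by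
      by_contra! h
      exact hx h
    rcases hx' with h | h
    · refine mul_eq_zero_of_left ?_ _
      rw [convolution_def]
      refine integral_eq_zero_of_ae (ae_of_all _ fun t => ?_)
      by_cases ht : 0 < t
      · simp [(testDeriv φ).eq_zero_of_notMem (x := x - t) fun h' => by linarith [h'.1]]
      · simp [dampedKernel, indicator_of_notMem (show t ∉ Ioi (0 : ℝ) from ht)]
    · refine mul_eq_zero_of_right _ ?_
      rw [convolution_def]
      refine integral_eq_zero_of_ae (ae_of_all _ fun t => ?_)
      by_cases ht : 0 < -t
      · simp [(testDeriv φ).eq_zero_of_notMem (x := x - t) fun h' => by linarith [h'.2]]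
      · simp [dampedKernel, indicator_of_notMem (show -t ∉ Ioi (0 : ℝ) from ht)]
  rw [hset, integral_convolution_mul_convolution hK hK' (test_integrable' _)
    (testDeriv φ).continuous (testDeriv φ).hasCompactSupport hf, ← integral_const_mul]
  have hF : ∀ ω, 𝓕 (fun t => (dampedKernel β ε t : ℂ)) ω
      * conj (𝓕 (fun t => (dampedKernel β ε (-t) : ℂ)) ω)
      = halfPlanePoint ε ω ^ (-((2 * β : ℝ) : ℂ)) := by
    intro ω
    have hz : 0 < (halfPlanePoint ε ω).re := by rwa [halfPlanePoint_re]
    have hz0 : halfPlanePoint ε ω ≠ 0 := by intro h; simp [h] at hz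
    rw [fourier_comp_neg_ofReal, Complex.conj_conj, fourier_dampedKernel' hβ hε,
      ← Complex.cpow_add _ _ hz0]
    push_cast
    ring_nf
  refine integral_mono_of_nonneg (ae_of_all _ fun ω => ?_) ?_ (ae_of_all _ fun ω => ?_)
  · have : 0 ≤ Real.cos (β * Real.pi) :=
      Real.cos_nonneg_of_mem_Icc ⟨by nlinarith [Real.pi_pos], by nlinarith [Real.pi_pos]⟩
    simp only [Pi.zero_apply]
    positivity
  · have hi := (integrable_fourier_mul hK (integrable_fourier_mul hK
      (integrable_norm_fourier_sq hf).ofReal)).re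
    refine hi.congr (ae_of_all _ fun ω => ?_)
    simp only [RCLike.re_eq_complex_re, fourier_comp_neg_ofReal, Complex.conj_conj, ← mul_assoc]
    exact Complex.re_mul_ofReal _ _
  · simp only [hF, ← mul_assoc]
    refine mul_le_mul_of_nonneg_right ?_ (sq_nonneg _)
    have h := le_re_cpow_neg (z := halfPlanePoint ε ω) (by rwa [halfPlanePoint_re])
      (s := 2 * β) (by linarith) (by linarith)
    rwa [show 2 * β * (Real.pi / 2) = β * Real.pi by ring] at h

end

/-! ### The derivative of the fractional integrals of a test function -/

/-- The derivative of the left fractional integral of a test function. -/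
noncomputable def leftDeriv (β : ℝ) (φ : Test) : ℝ → ℝ := unitKernel β ⋆ᵣ (testDeriv φ)

/-- The derivative of the right fractional integral of a test function. -/
noncomputable def rightDeriv (β : ℝ) (φ : Test) : ℝ → ℝ :=
  (fun t => unitKernel β (-t)) ⋆ᵣ (testDeriv φ)

variable {β : ℝ}

theorem setIntegral_leftDeriv_sq_le (hβ : 0 < β) (hβ1 : β ≤ 1) (φ : Test) :
    ∫ x in Ioo (0 : ℝ) 1, leftDeriv β φ x * leftDeriv β φ x
      ≤ (2 * Real.pi) ^ (2 - 2 * β) * energy (1 - β) φ :=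
  le_of_tendsto' ((kernelApprox hβ).tendsto_integral_mul (kernelApprox hβ) (testDeriv φ))
    fun n => setIntegral_conv_sq_le hβ hβ1 (damping_pos n) ((kernelApprox hβ).integrable n)
      (fun ω => by rw [fourier_dampedKernel' hβ (damping_pos n)]) φ

theorem setIntegral_rightDeriv_sq_le (hβ : 0 < β) (hβ1 : β ≤ 1) (φ : Test) :
    ∫ x in Ioo (0 : ℝ) 1, rightDeriv β φ x * rightDeriv β φ x
      ≤ (2 * Real.pi) ^ (2 - 2 * β) * energy (1 - β) φ :=
  le_of_tendsto' ((kernelApprox hβ).comp_neg.tendsto_integral_mul (kernelApprox hβ).comp_neg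
    (testDeriv φ)) fun n => setIntegral_conv_sq_le hβ hβ1 (damping_pos n)
      ((kernelApprox hβ).comp_neg.integrable n) (fun ω => by
        rw [fourier_comp_neg_ofReal, fourier_dampedKernel' hβ (damping_pos n), RCLike.norm_conj]) φ

theorem le_setIntegral_leftDeriv_mul_rightDeriv (hβ : 0 < β) (hβ1 : β ≤ 1 / 2) (φ : Test) :
    Real.cos (β * Real.pi) * ((2 * Real.pi) ^ (2 - 2 * β) * energy (1 - β) φ)
      ≤ ∫ x in Ioo (0 : ℝ) 1, leftDeriv β φ x * rightDeriv β φ x := by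
  have h := tendsto_integral_norm_rpow_mul (a := 2 * β) (by linarith) (by linarith) φ
  rw [mul_div_cancel_left₀ _ two_ne_zero] at h
  exact le_of_tendsto_of_tendsto' (h.const_mul _)
    ((kernelApprox hβ).tendsto_integral_mul (kernelApprox hβ).comp_neg (testDeriv φ))
    fun n => integral_conv_mul_conv_neg_ge hβ hβ1 (damping_pos n) φ

theorem le_setIntegral_leftDeriv_mul_testDeriv (hβ : 0 < β) (hβ1 : β ≤ 1) (φ : Test) :
    Real.cos (β * (Real.pi / 2)) * ((2 * Real.pi) ^ (2 - β) * energy (1 - β / 2) φ)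
      ≤ ∫ x in Ioo (0 : ℝ) 1, leftDeriv β φ x * testDeriv φ x :=
  le_of_tendsto_of_tendsto'
    ((tendsto_integral_norm_rpow_mul (a := β) (by linarith) (by linarith) φ).const_mul _)
    ((kernelApprox hβ).tendsto_integral_mul_test (testDeriv φ))
    fun n => integral_conv_mul_self_ge hβ hβ1 (damping_pos n) ((kernelApprox hβ).integrable n)
      (fun ω => by rw [fourier_dampedKernel' hβ (damping_pos n)]) φ

theorem le_setIntegral_rightDeriv_mul_testDeriv (hβ : 0 < β) (hβ1 : β ≤ 1) (φ : Test) :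
    Real.cos (β * (Real.pi / 2)) * ((2 * Real.pi) ^ (2 - β) * energy (1 - β / 2) φ)
      ≤ ∫ x in Ioo (0 : ℝ) 1, rightDeriv β φ x * testDeriv φ x :=
  le_of_tendsto_of_tendsto'
    ((tendsto_integral_norm_rpow_mul (a := β) (by linarith) (by linarith) φ).const_mul _)
    ((kernelApprox hβ).comp_neg.tendsto_integral_mul_test (testDeriv φ))
    fun n => integral_conv_mul_self_ge hβ hβ1 (damping_pos n)
      ((kernelApprox hβ).comp_neg.integrable n) (fun ω => by
        rw [fourier_comp_neg_ofReal, fourier_dampedKernel' hβ (damping_pos n),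
          Complex.conj_re]) φ

/-! ### Test functions as elements of `L²(0, 1)` -/

/-- The class of a continuous function in `L²(0, 1)`. -/
noncomputable def contL2 {f : ℝ → ℝ} (hf : Continuous f) : L2 := (memLp_of_continuous hf).toLp f

theorem coeFn_contL2 {f : ℝ → ℝ} (hf : Continuous f) : contL2 hf =ᵐ[vol01] f := MemLp.coeFn_toLp _

theorem inner_eq_integral (f g : L2) : inner ℝ f g = ∫ x in Ioo (0 : ℝ) 1, f x * g x := by
  rw [L2.inner_def]
  refine integral_congr_ae (ae_of_all _ fun x => ?_)
  simp [mul_comm]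

theorem inner_contL2 (h : L2) {f : ℝ → ℝ} (hf : Continuous f) :
    inner ℝ h (contL2 hf) = ∫ x in Ioo (0 : ℝ) 1, h x * f x := by
  rw [inner_eq_integral]
  refine integral_congr_ae ?_
  filter_upwards [coeFn_contL2 hf] with x hx
  rw [hx]

theorem inner_contL2_contL2 {f g : ℝ → ℝ} (hf : Continuous f) (hg : Continuous g) :
    inner ℝ (contL2 hf) (contL2 hg) = ∫ x in Ioo (0 : ℝ) 1, f x * g x := by
  rw [inner_contL2]
  refine integral_congr_ae ?_
  filter_upwards [coeFn_contL2 hf] with x hx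
  rw [hx]

/-- The inclusion of the test functions into `L²(0, 1)`. -/
noncomputable def testL2 : Test →ₗ[ℝ] L2 where
  toFun φ := contL2 φ.continuous
  map_add' _ _ := rfl
  map_smul' _ _ := rfl

theorem testL2_apply (φ : Test) : testL2 φ = contL2 φ.continuous := rfl

theorem norm_testL2_sq (φ : Test) : ‖testL2 φ‖ ^ 2 = ∫ x, φ x ^ 2 := by
  rw [← real_inner_self_eq_norm_sq, testL2_apply, inner_contL2_contL2,
    setIntegral_eq_integral_of_forall_compl_eq_zero fun x hx => by
      rw [φ.eq_zero_of_notMem hx, mul_zero]]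
  simp only [sq]

/-- Differentiation of test functions, with values in `L²(0, 1)`. -/
noncomputable def testDerivL2 : Test →ₗ[ℝ] L2 where
  toFun φ := testL2 (testDeriv φ)
  map_add' φ ψ := by rw [testDeriv_add, map_add]
  map_smul' c φ := by rw [testDeriv_smul, map_smul]; rfl

theorem norm_testDerivL2_sq (φ : Test) :
    ‖testDerivL2 φ‖ ^ 2 = (2 * Real.pi) ^ 2 * energy 1 φ := by
  rw [← integral_testDeriv_sq, ← norm_testL2_sq]
  rfl

theorem inner_testL2 (h : L2) (φ : Test) :
    inner ℝ h (testL2 φ) = ∫ x in Ioo (0 : ℝ) 1, h x * φ x :=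
  inner_contL2 h φ.continuous

theorem inner_testDerivL2 (h : L2) (φ : Test) :
    inner ℝ h (testDerivL2 φ) = ∫ x in Ioo (0 : ℝ) 1, h x * deriv φ x :=
  inner_contL2 h (testDeriv φ).continuous

theorem hasWeakDeriv_iff_inner {w g : L2} :
    HasWeakDeriv w g ↔ ∀ φ : Test, inner ℝ w (testDerivL2 φ) = -inner ℝ g (testL2 φ) := by
  simp only [HasWeakDeriv, inner_testL2, inner_testDerivL2]

theorem HasWeakDeriv.of_tendsto {w g : L2} {W G : ℕ → L2} (h : ∀ n, HasWeakDeriv (W n) (G n))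
    (hW : Tendsto W atTop (𝓝 w)) (hG : Tendsto G atTop (𝓝 g)) : HasWeakDeriv w g := by
  simp only [hasWeakDeriv_iff_inner] at h ⊢
  intro φ
  refine tendsto_nhds_unique (hW.inner tendsto_const_nhds) ?_
  simp only [h _ φ]
  exact (hG.inner tendsto_const_nhds).neg

theorem integral_mul_deriv_test {F F' : ℝ → ℝ} (hF : ∀ x, HasDerivAt F (F' x) x)
    (hF' : Continuous F') (φ : Test) :
    ∫ x in Ioo (0 : ℝ) 1, F x * deriv φ x = -∫ x in Ioo (0 : ℝ) 1, F' x * φ x := by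
  have hFc : Continuous F := continuous_iff_continuousAt.2 fun x => (hF x).continuousAt
  rw [setIntegral_eq_integral_of_forall_compl_eq_zero fun x hx => by
      rw [← coe_testDeriv, (testDeriv φ).eq_zero_of_notMem hx, mul_zero],
    setIntegral_eq_integral_of_forall_compl_eq_zero fun x hx => by
      rw [φ.eq_zero_of_notMem hx, mul_zero]]
  have hi {f : ℝ → ℝ} (hf : Continuous f) (ψ : Test) : Integrable (fun x => f x * ψ x) :=
    (hf.mul ψ.continuous).integrable_of_hasCompactSupport ψ.hasCompactSupport.mul_left
  exact integral_mul_deriv_eq_deriv_mul_of_integrable (fun x _ => hF x)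
    (fun x _ => (φ.differentiable x).hasDerivAt) (hi hFc (testDeriv φ)) (hi hF' φ) (hi hFc φ)

theorem hasWeakDeriv_contL2 {F F' : ℝ → ℝ} (hF : ∀ x, HasDerivAt F (F' x) x)
    (hFc : Continuous F) (hF' : Continuous F') : HasWeakDeriv (contL2 hFc) (contL2 hF') := by
  rw [hasWeakDeriv_iff_inner]
  intro φ
  have := integral_mul_deriv_test hF hF' φ
  rw [← coe_testDeriv, ← inner_contL2_contL2 hFc (testDeriv φ).continuous,
    ← inner_contL2_contL2 hF' φ.continuous] at this
  exact this

theorem hasWeakDeriv_test (φ : Test) : HasWeakDeriv (testL2 φ) (testDerivL2 φ) :=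
  hasWeakDeriv_contL2 (fun x => (φ.differentiable x).hasDerivAt) φ.continuous
    (testDeriv φ).continuous

/-! ### The fundamental lemma of du Bois-Reymond -/

theorem Test.exists_Icc (η : Test) :
    ∃ a b : ℝ, 0 < a ∧ b < 1 ∧ ∀ x, x ∉ Icc a b → η x = 0 := by
  have hc : IsCompact (tsupport η) := η.hasCompactSupport
  rcases (tsupport η).eq_empty_or_nonempty with h | h
  · refine ⟨1 / 2, 1 / 2, by norm_num, by norm_num, fun x _ => ?_⟩
    by_contra hne
    have := subset_tsupport _ (Function.mem_support.2 hne)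
    rw [h] at this
    exact this
  · refine ⟨sInf (tsupport η), sSup (tsupport η), (η.tsupport_subset (hc.sInf_mem h)).1,
      (η.tsupport_subset (hc.sSup_mem h)).2, fun x hx => ?_⟩
    by_contra hne
    have hm := subset_tsupport _ (Function.mem_support.2 hne)
    exact hx ⟨csInf_le hc.bddBelow hm, le_csSup hc.bddAbove hm⟩

/-- A test function with vanishing integral is the derivative of a test function. -/
theorem exists_testDeriv_eq {η : Test} (h0 : ∫ x, η x = 0) : ∃ Φ : Test, testDeriv Φ = η := by
  obtain ⟨a, b, ha, hb, hab⟩ := η.exists_Icc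
  have hd (x : ℝ) : HasDerivAt (fun x => ∫ t in (0 : ℝ)..x, η t) (η x) x :=
    intervalIntegral.integral_hasDerivAt_right (η.continuous.intervalIntegrable _ _)
      (η.continuous.stronglyMeasurableAtFilter _ _) η.continuous.continuousAt
  have hderiv : deriv (fun x => ∫ t in (0 : ℝ)..x, η t) = η := funext fun x => (hd x).deriv
  have hzero : ∀ x, x ∉ Icc a b → ∫ t in (0 : ℝ)..x, η t = 0 := by
    intro x hx
    have hx' : x < a ∨ b < x := by
      by_contra! h
      exact hx h
    rcases hx' with h | h
    · rw [intervalIntegral.integral_congr (g := fun _ => 0), intervalIntegral.integral_zero]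
      intro t ht
      refine hab t fun h' => ?_
      have := ht.2
      rcases le_total x 0 with h2 | h2
      · rw [max_eq_left h2] at this
        linarith [h'.1]
      · rw [max_eq_right h2] at this
        linarith [h'.1]
    · rcases le_or_gt 0 x with hx0 | hx0
      · rw [intervalIntegral.integral_of_le hx0, setIntegral_eq_integral_of_forall_compl_eq_zero, h0]
        intro t ht
        refine hab t fun h' => ht ⟨ha.trans_le h'.1, h'.2.trans h.le⟩
      · rw [intervalIntegral.integral_congr (g := fun _ => 0), intervalIntegral.integral_zero]
        intro t ht
        refine hab t fun h' => ?_
        have := ht.2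
        rw [max_eq_left hx0.le] at this
        linarith [h'.1]
  refine ⟨⟨fun x => ∫ t in (0 : ℝ)..x, η t, ?_, HasCompactSupport.intro isCompact_Icc hzero, ?_⟩, ?_⟩
  · rw [show ((⊤ : ℕ∞) : WithTop ℕ∞) = (⊤ : ℕ∞) from rfl, contDiff_infty_iff_deriv, hderiv]
    exact ⟨fun x => (hd x).differentiableAt, η.contDiff⟩
  · refine (closure_minimal (fun x hx => ?_) isClosed_Icc).trans
      (Icc_subset_Ioo ha hb : Icc a b ⊆ Ioo (0 : ℝ) 1)
    by_contra h
    exact hx (hzero x h)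
  · ext x
    exact (hd x).deriv

theorem exists_test_integral_eq_one : ∃ χ : Test, ∫ x, χ x = 1 := by
  let f : ContDiffBump (1 / 2 : ℝ) := ⟨1 / 8, 1 / 4, by norm_num, by norm_num⟩
  refine ⟨⟨f.normed volume, f.contDiff_normed, f.hasCompactSupport_normed, ?_⟩, f.integral_normed⟩
  rw [f.tsupport_normed_eq]
  intro x hx
  have hx' : |x - 1 / 2| ≤ 1 / 4 := by simpa [f, Real.dist_eq] using hx
  rw [abs_le] at hx'
  exact ⟨by linarith [hx'.1], by linarith [hx'.2]⟩

/-- With χ of integral one, η - (∫η)χ is the derivative of a test function for every η. Hence h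
minus the constant ∫hχ tests to zero against every η. -/
theorem ae_eq_const_of_forall_integral_deriv {h : ℝ → ℝ} (hh : IntegrableOn h (Ioo (0 : ℝ) 1))
    (h0 : ∀ φ : Test, ∫ x in Ioo (0 : ℝ) 1, h x * deriv φ x = 0) :
    ∃ c : ℝ, h =ᵐ[vol01] fun _ => c := by
  obtain ⟨χ, hχ⟩ := exists_test_integral_eq_one
  have hi (ψ : Test) : IntegrableOn (fun x => h x * ψ x) (Ioo (0 : ℝ) 1) := by
    obtain ⟨C, -, hC⟩ := ψ.exists_bound
    exact hh.mul_bdd (c := C) ψ.continuous.aestronglyMeasurable (ae_of_all _ hC)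
  have hset (ψ : Test) : ∫ x in Ioo (0 : ℝ) 1, ψ x = ∫ x, ψ x :=
    setIntegral_eq_integral_of_forall_compl_eq_zero fun x hx => ψ.eq_zero_of_notMem hx
  set c := ∫ x in Ioo (0 : ℝ) 1, h x * χ x with hc
  refine ⟨c, ?_⟩
  have key (η : Test) : ∫ x in Ioo (0 : ℝ) 1, (h x - c) * η x = 0 := by
    obtain ⟨Φ, hΦ⟩ := exists_testDeriv_eq (η := η - (∫ x, η x) • χ) (by
      simp only [FunLike.coe_sub, FunLike.coe_smul, Pi.sub_apply, Pi.smul_apply, smul_eq_mul]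
      rw [integral_sub (test_integrable' η) ((test_integrable' χ).const_mul _),
        integral_const_mul, hχ, mul_one, sub_self])
    have h1 := h0 Φ
    rw [← coe_testDeriv, hΦ] at h1
    simp only [FunLike.coe_sub, FunLike.coe_smul, Pi.sub_apply, Pi.smul_apply, smul_eq_mul,
      mul_sub, mul_left_comm (h _)] at h1
    rw [integral_sub (hi η) ((hi χ).const_mul _), integral_const_mul, ← hc] at h1
    simp only [sub_mul]
    rw [integral_sub (hi η) ((test_integrable' η).integrableOn.const_mul c), integral_const_mul,
      hset]
    linarith
  have hloc : LocallyIntegrableOn (fun x => h x - c) (Ioo (0 : ℝ) 1) volume :=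
    IntegrableOn.locallyIntegrableOn (hh.sub (by simp))
  have := isOpen_Ioo.ae_eq_zero_of_integral_contDiff_smul_eq_zero hloc (by
    intro φ h1 h2 h3
    let ψ : Test := ⟨φ, h1, h2, h3⟩
    rw [← key ψ, setIntegral_eq_integral_of_forall_compl_eq_zero fun x hx => by
      rw [ψ.eq_zero_of_notMem hx, mul_zero]]
    refine integral_congr_ae (ae_of_all _ fun x => ?_)
    simp only [smul_eq_mul]
    exact mul_comm _ _)
  filter_upwards [(ae_restrict_iff' measurableSet_Ioo).2 this] with x hx
  linarith

/-- The constant function `1` in `L²(0, 1)`. -/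
noncomputable def oneL2 : L2 := contL2 (f := fun _ => 1) continuous_const

theorem norm_oneL2 : ‖oneL2‖ = 1 := by
  have : ‖oneL2‖ ^ 2 = 1 := by
    rw [← real_inner_self_eq_norm_sq, oneL2, inner_contL2_contL2]
    simp
  exact (pow_eq_one_iff_of_nonneg (norm_nonneg _) two_ne_zero).1 this

theorem coeFn_smul_oneL2 (c : ℝ) : (c • oneL2 : L2) =ᵐ[vol01] fun _ => c := by
  filter_upwards [Lp.coeFn_smul c oneL2, coeFn_contL2 (f := fun _ => 1) continuous_const]
    with x h1 h2
  rw [h1, Pi.smul_apply, oneL2, h2, smul_eq_mul, mul_one]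

theorem exists_eq_smul_oneL2 {h : L2} (h0 : ∀ φ : Test, inner ℝ h (testDerivL2 φ) = 0) :
    ∃ c : ℝ, h = c • oneL2 := by
  obtain ⟨c, hc⟩ := ae_eq_const_of_forall_integral_deriv (L2_integrable h) fun φ => by
    rw [← inner_testDerivL2, h0]
  exact ⟨c, Lp.ext (hc.trans (coeFn_smul_oneL2 c).symm)⟩

theorem hasWeakDeriv_oneL2 : HasWeakDeriv oneL2 0 := by
  have h := hasWeakDeriv_contL2 (F := fun _ => 1) (F' := fun _ => 0)
    (fun x => hasDerivAt_const x 1) continuous_const continuous_const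
  have e : contL2 (f := fun _ => (0 : ℝ)) continuous_const = 0 := rfl
  rwa [e] at h

theorem inner_oneL2_testDerivL2 (φ : Test) : inner ℝ oneL2 (testDerivL2 φ) = 0 := by
  rw [hasWeakDeriv_iff_inner.1 hasWeakDeriv_oneL2, inner_zero_left, neg_zero]

/-- Functions of mean zero are limits of derivatives of test functions. -/
theorem exists_seq_testDerivL2 {g : L2} (hg : inner ℝ oneL2 g = 0) :
    ∃ φ : ℕ → Test, Tendsto (fun n => testDerivL2 (φ n)) atTop (𝓝 g) := by
  -- By du Bois-Reymond the orthogonal complement of the test derivatives consists of constants; the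
  -- double complement is the closure.
  have h1 : g ∈ (LinearMap.range testDerivL2)ᗮᗮ := by
    rw [Submodule.mem_orthogonal]
    intro h hh
    obtain ⟨c, rfl⟩ := exists_eq_smul_oneL2 (h := h) fun φ => by
      rw [real_inner_comm]
      exact hh _ ⟨φ, rfl⟩
    rw [real_inner_smul_left, hg, mul_zero]
  rw [Submodule.orthogonal_orthogonal_eq_closure] at h1
  obtain ⟨y, hy, hlim⟩ := mem_closure_iff_seq_limit.1 h1
  choose φ hφ using hy
  exact ⟨φ, by simpa only [hφ] using hlim⟩

/-! ### Sequential description of the spaces `H^μ₀` -/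

/-- A sequence of test functions is Cauchy for the homogeneous Sobolev seminorm. -/
def EnergyCauchy (s : ℝ) (φ : ℕ → Test) : Prop :=
  ∀ ε > 0, ∃ N, ∀ n ≥ N, ∀ m ≥ N, energy s (φ n - φ m) ≤ ε

variable {s : ℝ}

theorem norm_testL2_sq_le (hs0 : 0 ≤ s) (hs1 : s ≤ 1) (φ : Test) :
    ‖testL2 φ‖ ^ 2 ≤ 2 * 4 ^ (2 * s) * energy s φ := by
  rw [norm_testL2_sq]
  exact integral_sq_le_energy hs0 hs1 φ

theorem cauchySeq_of_forall_norm_sq_le {E : Type*} [NormedAddCommGroup E] [NormedSpace ℝ E]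
    {T : Test →ₗ[ℝ] E} {C : ℝ} (hT : ∀ φ, ‖T φ‖ ^ 2 ≤ C * energy s φ)
    {φ : ℕ → Test} (h : EnergyCauchy s φ) : CauchySeq fun n => T (φ n) := by
  rw [Metric.cauchySeq_iff]
  intro ε hε
  obtain ⟨N, hN⟩ := h (ε ^ 2 / (2 * (|C| + 1))) (by positivity)
  refine ⟨N, fun m hm n hn => ?_⟩
  rw [dist_eq_norm, ← map_sub]
  refine lt_of_pow_lt_pow_left₀ 2 hε.le ((hT _).trans_lt ?_)
  have h1 := hN m hm n hn
  have h2 : C * energy s (φ m - φ n) ≤ (|C| + 1) * (ε ^ 2 / (2 * (|C| + 1))) := by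
    refine mul_le_mul ?_ h1 (energy_nonneg _ _) (by positivity)
    linarith [le_abs_self C]
  have h3 : (|C| + 1) * (ε ^ 2 / (2 * (|C| + 1))) = ε ^ 2 / 2 := by
    field_simp
  have : 0 < ε ^ 2 := by positivity
  linarith

theorem EnergyCauchy.of_norm_sq {E : Type*} [NormedAddCommGroup E] [NormedSpace ℝ E]
    {T : Test →ₗ[ℝ] E} {C : ℝ} (hT : ∀ φ, energy s φ ≤ C * ‖T φ‖ ^ 2)
    {φ : ℕ → Test} (h : CauchySeq fun n => T (φ n)) : EnergyCauchy s φ := by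
  intro ε hε
  rw [Metric.cauchySeq_iff] at h
  obtain ⟨N, hN⟩ := h (Real.sqrt (ε / (|C| + 1))) (by positivity)
  refine ⟨N, fun n hn m hm => (hT _).trans ?_⟩
  have h1 := hN n hn m hm
  rw [dist_eq_norm, ← map_sub] at h1
  have h2 : ‖T (φ n - φ m)‖ ^ 2 ≤ ε / (|C| + 1) := by
    rw [← Real.sq_sqrt (show 0 ≤ ε / (|C| + 1) by positivity)]
    gcongr
  calc C * ‖T (φ n - φ m)‖ ^ 2 ≤ (|C| + 1) * (ε / (|C| + 1)) := by
        refine mul_le_mul ?_ h2 (by positivity) (by positivity)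
        linarith [le_abs_self C]
    _ = ε := by field_simp

theorem EnergyCauchy.exists_tendsto (hs0 : 0 ≤ s) (hs1 : s ≤ 1) {φ : ℕ → Test}
    (h : EnergyCauchy s φ) : ∃ u : L2, Tendsto (fun n => testL2 (φ n)) atTop (𝓝 u) :=
  cauchySeq_tendsto_of_complete (cauchySeq_of_forall_norm_sq_le (norm_testL2_sq_le hs0 hs1) h)

theorem eLpNorm_sub_zeroExt (φ : Test) (u : L2) :
    eLpNorm (⇑φ - zeroExt u) 2 volume = ENNReal.ofReal ‖testL2 φ - u‖ := by
  rw [Lp.norm_def, ENNReal.ofReal_toReal (Lp.eLpNorm_ne_top _)]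
  have e : (⇑φ - zeroExt u) = (Ioo (0 : ℝ) 1).indicator (⇑φ - ⇑u) := by
    ext x
    by_cases hx : x ∈ Ioo (0 : ℝ) 1
    · simp [zeroExt, indicator_of_mem hx]
    · simp [zeroExt, indicator_of_notMem hx, φ.eq_zero_of_notMem hx]
  rw [e, eLpNorm_indicator_eq_eLpNorm_restrict measurableSet_Ioo]
  refine eLpNorm_congr_ae ?_
  filter_upwards [Lp.coeFn_sub (testL2 φ) u, coeFn_contL2 φ.continuous] with x h1 h2
  rw [h1, Pi.sub_apply, Pi.sub_apply, testL2_apply, h2]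

theorem integral_norm_sub_zeroExt_le (φ : Test) (u : L2) :
    ∫ x, ‖(⇑φ - zeroExt u) x‖ ≤ ‖testL2 φ - u‖ := by
  have hi : Integrable (⇑φ - zeroExt u) := (test_integrable' φ).sub (zeroExt_integrable u)
  rw [integral_norm_eq_lintegral_enorm hi.aestronglyMeasurable, ← eLpNorm_one_eq_lintegral_enorm]
  refine ENNReal.toReal_le_of_le_ofReal (norm_nonneg _) ?_
  rw [← eLpNorm_sub_zeroExt]
  have e : (⇑φ - zeroExt u) = (Ioo (0 : ℝ) 1).indicator (⇑φ - zeroExt u) := by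
    ext x
    by_cases hx : x ∈ Ioo (0 : ℝ) 1
    · simp [indicator_of_mem hx]
    · simp [zeroExt, indicator_of_notMem hx, φ.eq_zero_of_notMem hx]
  rw [e, eLpNorm_indicator_eq_eLpNorm_restrict measurableSet_Ioo,
    eLpNorm_indicator_eq_eLpNorm_restrict measurableSet_Ioo]
  have hp : IsProbabilityMeasure vol01 := ⟨by simp⟩
  exact eLpNorm_le_eLpNorm_of_exponent_le (by norm_num) hi.aestronglyMeasurable.restrict

theorem fourier_sub {f g : ℝ → ℝ} (hf : Integrable f) (hg : Integrable g) (ω : ℝ) :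
    𝓕 (fun x => ((f - g) x : ℂ)) ω = 𝓕 (fun x => (f x : ℂ)) ω - 𝓕 (fun x => (g x : ℂ)) ω := by
  rw [Real.fourier_eq, Real.fourier_eq, Real.fourier_eq, ← integral_sub]
  · simp [smul_sub]
  · exact (Real.fourierIntegral_convergent_iff ω).2 hf.ofReal
  · exact (Real.fourierIntegral_convergent_iff ω).2 hg.ofReal

theorem tendsto_testFourier {φ : ℕ → Test} {u : L2}
    (h : Tendsto (fun n => testL2 (φ n)) atTop (𝓝 u)) (ω : ℝ) :
    Tendsto (fun n => testFourier (φ n) ω) atTop (𝓝 (𝓕 (fun x => (zeroExt u x : ℂ)) ω)) := by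
  rw [tendsto_iff_norm_sub_tendsto_zero] at h ⊢
  refine squeeze_zero (fun _ => norm_nonneg _) (fun n => ?_) h
  refine le_trans ?_ (integral_norm_sub_zeroExt_le (φ n) u)
  rw [testFourier, ← fourier_sub (test_integrable' _) (zeroExt_integrable u)]
  refine (VectorFourier.norm_fourierIntegral_le_integral_norm _ _ _ _ _).trans (le_of_eq ?_)
  simp only [Complex.norm_real]

/-- Fatou's lemma for the homogeneous Sobolev seminorm. -/
theorem sobolevSeminorm_sub_zeroExt_le {φ : ℕ → Test} {u : L2}
    (h : Tendsto (fun n => testL2 (φ n)) atTop (𝓝 u)) (ψ : Test) {c : ℝ≥0∞}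
    (hc : ∀ᶠ n in atTop, sobolevSeminorm s (⇑ψ - ⇑(φ n)) ≤ c) :
    sobolevSeminorm s (⇑ψ - zeroExt u) ≤ c := by
  refine le_trans (Lp.eLpNorm_lim_le_liminf_eLpNorm (f := fun n (ω : ℝ) =>
    ((|ω| ^ s : ℝ) : ℂ) * 𝓕 (fun x => ((⇑ψ - ⇑(φ n)) x : ℂ)) ω)
    (fun n => fourier_aesm ((test_integrable' ψ).sub (test_integrable' (φ n))) s) _
    (ae_of_all _ fun ω => ?_)) (liminf_le_of_frequently_le' hc.frequently)
  simp only [fourier_sub (test_integrable' ψ) (zeroExt_integrable u),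
    fourier_sub (test_integrable' ψ) (test_integrable' _)]
  exact (tendsto_const_nhds.sub (tendsto_testFourier h ω)).const_mul _

theorem sobolevSeminorm_le_ofReal_sqrt (hs0 : 0 ≤ s) (hs1 : s ≤ 1) {φ : Test} {ε : ℝ}
    (hε : 0 ≤ ε) (h : energy s φ ≤ ε ^ 2) : sobolevSeminorm s φ ≤ ENNReal.ofReal ε := by
  rw [← ENNReal.pow_le_pow_left_iff two_ne_zero, sobolevSeminorm_sq s hs0 hs1,
    ← ENNReal.ofReal_pow hε]
  exact ENNReal.ofReal_le_ofReal h

/-- L² convergence gives pointwise convergence of the transforms. Fatou's lemma then carries the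
Cauchy estimate on φ_n - φ_m to φ_n - u as m grows. -/
theorem EnergyCauchy.mem_Hzero (hs0 : 0 ≤ s) (hs1 : s ≤ 1) {φ : ℕ → Test} (h : EnergyCauchy s φ)
    {u : L2} (hu : Tendsto (fun n => testL2 (φ n)) atTop (𝓝 u)) : u ∈ Hzero s := by
  refine ⟨φ, tendsto_sobolevNorm_iff.2 ⟨?_, ?_⟩⟩
  · simp only [eLpNorm_sub_zeroExt]
    have := (ENNReal.continuous_ofReal.tendsto _).comp (tendsto_iff_norm_sub_tendsto_zero.1 hu)
    simpa [Function.comp_def] using this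
  · rw [ENNReal.tendsto_nhds_zero]
    intro ε hε
    rcases eq_or_ne ε ⊤ with rfl | hε'
    · exact Eventually.of_forall fun _ => le_top
    have hpos : 0 < ε.toReal := ENNReal.toReal_pos hε.ne' hε'
    obtain ⟨N, hN⟩ := h (ε.toReal ^ 2) (by positivity)
    filter_upwards [eventually_ge_atTop N] with n hn
    refine sobolevSeminorm_sub_zeroExt_le hu (φ n) ?_
    filter_upwards [eventually_ge_atTop N] with m hm
    have := sobolevSeminorm_le_ofReal_sqrt hs0 hs1 hpos.le (hN n hn m hm)
    rwa [ENNReal.ofReal_toReal hε', FunLike.coe_sub] at this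

/-- Converse of `EnergyCauchy.mem_Hzero`. From here on the spaces are handled through sequences of
test functions and real-valued energies. -/
theorem exists_energyCauchy (hs0 : 0 ≤ s) (hs1 : s ≤ 1) {u : L2} (hu : u ∈ Hzero s) :
    ∃ φ : ℕ → Test, EnergyCauchy s φ ∧ Tendsto (fun n => testL2 (φ n)) atTop (𝓝 u) := by
  obtain ⟨φ, hφ⟩ := hu
  obtain ⟨h1, h2⟩ := tendsto_sobolevNorm_iff.1 hφ
  refine ⟨φ, ?_, ?_⟩
  · intro ε hε
    rw [ENNReal.tendsto_nhds_zero] at h2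
    obtain ⟨N, hN⟩ := eventually_atTop.1 (h2 (ENNReal.ofReal (Real.sqrt ε / 2)) (by simpa using hε))
    refine ⟨N, fun n hn m hm => ?_⟩
    have hi (k : ℕ) := (test_integrable' (φ k)).sub (zeroExt_integrable u)
    have e : ⇑(φ n - φ m) = (⇑(φ n) - zeroExt u) + (-1 : ℝ) • (⇑(φ m) - zeroExt u) := by
      rw [FunLike.coe_sub]
      module
    have h3 := sobolevSeminorm_add_le s (hi n) ((hi m).smul (-1 : ℝ))
    rw [sobolevSeminorm_smul, ← e] at h3
    simp only [enorm_neg, enorm_one, one_mul] at h3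
    have h4 := h3.trans (add_le_add (hN n hn) (hN m hm))
    rw [← ENNReal.ofReal_add (by positivity) (by positivity), add_halves,
      ← ENNReal.pow_le_pow_left_iff two_ne_zero, sobolevSeminorm_sq s hs0 hs1,
      ← ENNReal.ofReal_pow (by positivity), Real.sq_sqrt hε.le,
      ENNReal.ofReal_le_ofReal_iff hε.le] at h4
    exact h4
  · rw [tendsto_iff_norm_sub_tendsto_zero]
    simp only [eLpNorm_sub_zeroExt] at h1
    have := (ENNReal.tendsto_toReal ENNReal.zero_ne_top).comp h1
    simpa [Function.comp_def, ENNReal.toReal_ofReal] using this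

/-! ### The space `H¹₀(0, 1)` -/

theorem energy_one_le (φ : Test) : energy 1 φ ≤ 1 / (2 * Real.pi) ^ 2 * ‖testDerivL2 φ‖ ^ 2 := by
  rw [norm_testDerivL2_sq]
  field_simp
  rfl

theorem exists_seq_of_mem_Hzero_one {u : L2} (hu : u ∈ Hzero 1) :
    ∃ (φ : ℕ → Test) (g : L2), Tendsto (fun n => testL2 (φ n)) atTop (𝓝 u) ∧
      Tendsto (fun n => testDerivL2 (φ n)) atTop (𝓝 g) ∧ HasWeakDeriv u g := by
  obtain ⟨φ, h1, h2⟩ := exists_energyCauchy zero_le_one le_rfl hu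
  obtain ⟨g, hg⟩ := cauchySeq_tendsto_of_complete
    (cauchySeq_of_forall_norm_sq_le (fun φ => (norm_testDerivL2_sq φ).le) h1)
  exact ⟨φ, g, h2, hg, HasWeakDeriv.of_tendsto (fun n => hasWeakDeriv_test (φ n)) h2 hg⟩

theorem D_eq {w : H1} {g : L2} (h : HasWeakDeriv w g) : D w = g := (D_spec w).unique h

theorem inner_oneL2_D (w : H10) : inner ℝ oneL2 (D (w : H1)) = 0 := by
  obtain ⟨φ, g, -, h2, h3⟩ := exists_seq_of_mem_Hzero_one (u := ((w : H1) : L2)) w.2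
  rw [D_eq h3]
  refine tendsto_nhds_unique (tendsto_const_nhds.inner h2) ?_
  simp only [inner_oneL2_testDerivL2]
  exact tendsto_const_nhds

theorem eq_zero_of_D_eq_zero {w : H10} (h : D (w : H1) = 0) : w = 0 := by
  obtain ⟨φ, g, h1, h2, h3⟩ := exists_seq_of_mem_Hzero_one (u := ((w : H1) : L2)) w.2
  rw [D_eq h3] at h
  subst h
  have h4 : ‖((w : H1) : L2)‖ ^ 2 ≤ 0 := by
    have h5 := (((h2.norm.pow 2).const_mul (1 / (2 * Real.pi) ^ 2)).const_mul
      (2 * (4 : ℝ) ^ (2 * (1 : ℝ))))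
    have h6 := le_of_tendsto_of_tendsto' (h1.norm.pow 2) h5 fun n =>
      (norm_testL2_sq_le zero_le_one le_rfl (φ n)).trans (by gcongr; exact energy_one_le _)
    simpa using h6
  have h5 : ((w : H1) : L2) = 0 := by
    rw [← norm_eq_zero]
    exact pow_eq_zero_iff two_ne_zero |>.1 (le_antisymm h4 (sq_nonneg _))
  exact Subtype.ext (Subtype.ext h5)

/-- Approximate `g` by derivatives of test functions: their L² convergence is the Cauchy property of
order 1, and Poincaré makes the test functions themselves converge. -/
theorem exists_H10_D_eq {g : L2} (hg : inner ℝ oneL2 g = 0) : ∃ w : H10, D (w : H1) = g := by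
  obtain ⟨φ, hφ⟩ := exists_seq_testDerivL2 hg
  have hE : EnergyCauchy 1 φ := EnergyCauchy.of_norm_sq energy_one_le hφ.cauchySeq
  obtain ⟨u, hu⟩ := hE.exists_tendsto zero_le_one le_rfl
  have hw := HasWeakDeriv.of_tendsto (fun n => hasWeakDeriv_test (φ n)) hu hφ
  exact ⟨⟨⟨u, g, hw⟩, hE.mem_Hzero zero_le_one le_rfl hu⟩, D_eq hw⟩

/-! ### The fractional integrals as convolutions -/

theorem leftInt_eq_conv (β : ℝ) (u : L2) {x : ℝ} (hx : x ∈ Ioo (0 : ℝ) 1) :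
    leftInt β u x = (unitKernel β ⋆ᵣ zeroExt u) x := by
  rw [leftInt, convolution_eq_swap, ← integral_const_mul, ← integral_indicator measurableSet_Ioo]
  congr 1
  ext s
  by_cases hs : s ∈ Ioo 0 x
  · have h1 : s ∈ Ioo (0 : ℝ) 1 := ⟨hs.1, hs.2.trans hx.2⟩
    have h2 : x - s ∈ Ioo (0 : ℝ) 1 := ⟨sub_pos.2 hs.2, by linarith [hs.1, hx.2]⟩
    simp only [indicator_of_mem hs, ContinuousLinearMap.mul_apply', unitKernel, zeroExt,
      indicator_of_mem h1, indicator_of_mem h2]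
    rw [show β - 1 = -(1 - β) by ring, Real.rpow_neg h2.1.le]
    field_simp
  · rw [indicator_of_notMem hs, ContinuousLinearMap.mul_apply']
    by_cases h1 : s ∈ Ioo (0 : ℝ) 1
    · have h2 : x - s ∉ Ioo (0 : ℝ) 1 := fun h => hs ⟨h1.1, by linarith [h.1]⟩
      rw [unitKernel, indicator_of_notMem h2, zero_mul]
    · rw [zeroExt, indicator_of_notMem h1, mul_zero]

theorem rightInt_eq_conv (β : ℝ) (u : L2) {x : ℝ} (hx : x ∈ Ioo (0 : ℝ) 1) :
    rightInt β u x = ((fun t => unitKernel β (-t)) ⋆ᵣ zeroExt u) x := by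
  rw [rightInt, convolution_eq_swap, ← integral_const_mul, ← integral_indicator measurableSet_Ioo]
  congr 1
  ext s
  by_cases hs : s ∈ Ioo x 1
  · have h1 : s ∈ Ioo (0 : ℝ) 1 := ⟨hx.1.trans hs.1, hs.2⟩
    have h2 : s - x ∈ Ioo (0 : ℝ) 1 := ⟨sub_pos.2 hs.1, by linarith [hs.2, hx.1]⟩
    simp only [indicator_of_mem hs, ContinuousLinearMap.mul_apply', unitKernel, zeroExt,
      indicator_of_mem h1, neg_sub, indicator_of_mem h2]
    rw [show β - 1 = -(1 - β) by ring, Real.rpow_neg h2.1.le]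
    field_simp
  · rw [indicator_of_notMem hs, ContinuousLinearMap.mul_apply', neg_sub]
    by_cases h1 : s ∈ Ioo (0 : ℝ) 1
    · have h2 : s - x ∉ Ioo (0 : ℝ) 1 := fun h => hs ⟨by linarith [h.1], h1.2⟩
      rw [unitKernel, indicator_of_notMem h2, zero_mul]
    · rw [zeroExt, indicator_of_notMem h1, mul_zero]

theorem integral_norm_conv_le {K f : ℝ → ℝ} (hK : Integrable K) (hf : Integrable f) :
    ∫ x, ‖(K ⋆ᵣ f) x‖ ≤ (∫ t, ‖K t‖) * ∫ x, ‖f x‖ := by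
  have h := integral_convolution (ContinuousLinearMap.mul ℝ ℝ) (μ := volume) (ν := volume)
    hK.norm hf.norm
  rw [ContinuousLinearMap.mul_apply'] at h
  rw [← h]
  refine integral_mono (hK.integrable_convolution _ hf).norm
    (hK.norm.integrable_convolution _ hf.norm) fun x => ?_
  simp only [convolution_def, ContinuousLinearMap.mul_apply', ← norm_mul]
  exact norm_integral_le_integral_norm _

theorem conv_sub_ae {K f g : ℝ → ℝ} (hK : Integrable K) (hf : Integrable f) (hg : Integrable g) :
    K ⋆ᵣ (f - g) =ᵐ[volume] (K ⋆ᵣ f) - (K ⋆ᵣ g) := by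
  filter_upwards [hK.ae_convolution_exists (ContinuousLinearMap.mul ℝ ℝ) hf,
    hK.ae_convolution_exists (ContinuousLinearMap.mul ℝ ℝ) hg] with x h1 h2
  simp only [convolution_def, Pi.sub_apply, map_sub]
  exact integral_sub h1 h2

theorem tendsto_setIntegral_conv_mul {K : ℝ → ℝ} (hK : Integrable K) {φ : ℕ → Test} {u : L2}
    (hu : Tendsto (fun n => testL2 (φ n)) atTop (𝓝 u)) (ψ : Test) :
    Tendsto (fun n => ∫ x in Ioo (0 : ℝ) 1, (K ⋆ᵣ (φ n)) x * ψ x) atTop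
      (𝓝 (∫ x in Ioo (0 : ℝ) 1, (K ⋆ᵣ zeroExt u) x * ψ x)) := by
  obtain ⟨C, hC0, hC⟩ := ψ.exists_bound
  have hiu := hK.integrable_convolution (ContinuousLinearMap.mul ℝ ℝ) (zeroExt_integrable u)
  have hiφ (n : ℕ) :=
    hK.integrable_convolution (ContinuousLinearMap.mul ℝ ℝ) (test_integrable' (φ n))
  have hmul {f : ℝ → ℝ} (hf : Integrable f) : Integrable fun x => f x * ψ x :=
    hf.mul_bdd ψ.continuous.aestronglyMeasurable (ae_of_all _ hC)
  rw [tendsto_iff_norm_sub_tendsto_zero] at hu ⊢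
  refine squeeze_zero (g := fun n => (∫ t, ‖K t‖) * ‖testL2 (φ n) - u‖ * C)
    (fun _ => norm_nonneg _) (fun n => ?_) (by simpa using (hu.const_mul _).mul_const C)
  rw [← integral_sub (hmul (hiφ n)).integrableOn (hmul hiu).integrableOn]
  have hd := conv_sub_ae hK (test_integrable' (φ n)) (zeroExt_integrable u)
  have hid := (test_integrable' (φ n)).sub (zeroExt_integrable u)
  have hic := hK.integrable_convolution (ContinuousLinearMap.mul ℝ ℝ) hid
  calc ‖∫ x in Ioo (0 : ℝ) 1, ((K ⋆ᵣ (φ n)) x * ψ x - (K ⋆ᵣ zeroExt u) x * ψ x)‖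
      ≤ ∫ x in Ioo (0 : ℝ) 1, ‖(K ⋆ᵣ (⇑(φ n) - zeroExt u)) x‖ * C := by
        refine norm_integral_le_of_norm_le (hic.norm.mul_const C).integrableOn ?_
        filter_upwards [ae_restrict_of_ae hd] with x hx
        rw [← sub_mul, hx, norm_mul, Pi.sub_apply]
        gcongr
        exact hC x
    _ ≤ ∫ x, ‖(K ⋆ᵣ (⇑(φ n) - zeroExt u)) x‖ * C :=
        setIntegral_le_integral (hic.norm.mul_const C)
          (ae_of_all _ fun x => mul_nonneg (norm_nonneg _) hC0)
    _ = (∫ x, ‖(K ⋆ᵣ (⇑(φ n) - zeroExt u)) x‖) * C := integral_mul_const _ _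
    _ ≤ _ := by
        gcongr
        refine (integral_norm_conv_le hK hid).trans ?_
        gcongr
        exact integral_norm_sub_zeroExt_le (φ n) u

/-- Convolution of a kernel with the derivative of a test function. -/
noncomputable def convDerivL2 {K : ℝ → ℝ} (hK : Integrable K) : Test →ₗ[ℝ] L2 where
  toFun φ := contL2 (continuous_conv hK (testDeriv φ))
  map_add' φ ψ := by
    have e : K ⋆ᵣ (testDeriv (φ + ψ)) = K ⋆ᵣ (testDeriv φ) + K ⋆ᵣ (testDeriv ψ) := by
      have hc (η : Test) : ConvolutionExists K η (ContinuousLinearMap.mul ℝ ℝ) volume :=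
        η.hasCompactSupport.convolutionExists_right _ hK.locallyIntegrable η.continuous
      rw [testDeriv_add, FunLike.coe_add]
      exact (hc _).distrib_add (hc _)
    simp only [contL2, e]
    rfl
  map_smul' c φ := by
    have e : K ⋆ᵣ (testDeriv (c • φ)) = c • (K ⋆ᵣ (testDeriv φ)) := by
      rw [testDeriv_smul, FunLike.coe_smul]
      exact convolution_smul
    simp only [contL2, e]
    rfl

/-- For each φ_n the derivative falls on the test function inside the convolution. The limit needs
only L¹ control of the convolutions and L² convergence of their derivatives. -/
theorem setIntegral_conv_mul_deriv {K : ℝ → ℝ} (hK : Integrable K) {φ : ℕ → Test} {u g : L2}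
    (hu : Tendsto (fun n => testL2 (φ n)) atTop (𝓝 u))
    (hg : Tendsto (fun n => convDerivL2 hK (φ n)) atTop (𝓝 g)) (ψ : Test) :
    ∫ x in Ioo (0 : ℝ) 1, (K ⋆ᵣ zeroExt u) x * deriv ψ x = -∫ x in Ioo (0 : ℝ) 1, g x * ψ x := by
  refine tendsto_nhds_unique (tendsto_setIntegral_conv_mul hK hu (testDeriv ψ)) ?_
  have h1 : Tendsto (fun n => -inner ℝ (convDerivL2 hK (φ n)) (testL2 ψ)) atTop
      (𝓝 (-inner ℝ g (testL2 ψ))) := (hg.inner tendsto_const_nhds).neg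
  rw [inner_testL2] at h1
  refine h1.congr fun n => ?_
  have hd (x : ℝ) : HasDerivAt (K ⋆ᵣ (φ n)) ((K ⋆ᵣ (testDeriv (φ n))) x) x :=
    (φ n).hasCompactSupport.hasDerivAt_convolution_right _ hK.locallyIntegrable
      ((φ n).contDiff.of_le (by simp)) x
  rw [coe_testDeriv, integral_mul_deriv_test hd (continuous_conv hK _), testL2_apply]
  exact congrArg Neg.neg (inner_contL2_contL2 (continuous_conv hK (testDeriv (φ n))) ψ.continuous)

/-! ### Primitives of square integrable functions -/

theorem hasWeakDeriv_wr : HasWeakDeriv wr oneL2 :=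
  hasWeakDeriv_contL2 (F := fun x => x) (fun x => hasDerivAt_id x) continuous_id continuous_const

theorem hasWeakDeriv_wl : HasWeakDeriv wl (-oneL2) := by
  have h := hasWeakDeriv_contL2 (F := fun x => 1 - x) (F' := fun _ => -1)
    (fun x => by simpa using (hasDerivAt_id x).const_sub 1) (by fun_prop) continuous_const
  exact h

theorem inner_oneL2_sub (g : L2) : inner ℝ oneL2 (g - (inner ℝ oneL2 g : ℝ) • oneL2) = 0 := by
  rw [inner_sub_right, real_inner_smul_right, real_inner_self_eq_norm_sq, norm_oneL2]
  ring

/-- Remove the mean, integrate within `H10`, and restore the mean by a multiple of x. -/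
theorem exists_hasWeakDeriv (g : L2) : ∃ w : L2, HasWeakDeriv w g := by
  obtain ⟨w, hw⟩ := exists_H10_D_eq (inner_oneL2_sub g)
  refine ⟨w + (inner ℝ oneL2 g : ℝ) • wr, ?_⟩
  have h := (D_spec (w : H1)).add (hasWeakDeriv_wr.smul (inner ℝ oneL2 g))
  rwa [hw, sub_add_cancel] at h

/-- A fractional integral is at first known only to be integrable. It differs from an L² primitive
of `g` by a constant, and is therefore itself in L². -/
theorem exists_hasWeakDeriv_ae_eq {F : ℝ → ℝ} (hF : IntegrableOn F (Ioo (0 : ℝ) 1)) {g : L2}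
    (h : ∀ ψ : Test, ∫ x in Ioo (0 : ℝ) 1, F x * deriv ψ x
      = -∫ x in Ioo (0 : ℝ) 1, g x * ψ x) :
    ∃ w : L2, w =ᵐ[vol01] F ∧ HasWeakDeriv w g := by
  obtain ⟨w, hw⟩ := exists_hasWeakDeriv g
  obtain ⟨c, hc⟩ := ae_eq_const_of_forall_integral_deriv (hF.sub (L2_integrable w)) fun ψ => by
    have hi : IntegrableOn (fun x => F x * deriv ψ x) (Ioo (0 : ℝ) 1) := by
      obtain ⟨C, -, hC⟩ := (testDeriv ψ).exists_bound
      exact hF.mul_bdd (testDeriv ψ).continuous.aestronglyMeasurable (ae_of_all _ hC)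
    simp only [Pi.sub_apply, sub_mul]
    rw [integral_sub hi (test_deriv_integrable ψ w), h ψ, hw ψ, sub_self]
  refine ⟨w + c • oneL2, ?_, ?_⟩
  · filter_upwards [hc, Lp.coeFn_add w (c • oneL2), coeFn_smul_oneL2 c] with x h1 h2 h3
    rw [h2, Pi.add_apply, h3]
    rw [Pi.sub_apply] at h1
    linarith
  · simpa using hw.add (hasWeakDeriv_oneL2.smul c)

/-! ### The derivatives of the one-sided fractional integrals -/

theorem integrable_unitKernel_neg (hβ : 0 < β) : Integrable fun t => unitKernel β (-t) :=
  (integrable_unitKernel hβ).comp_neg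

theorem continuous_leftDeriv (hβ : 0 < β) (φ : Test) : Continuous (leftDeriv β φ) :=
  continuous_conv (integrable_unitKernel hβ) (testDeriv φ)

theorem continuous_rightDeriv (hβ : 0 < β) (φ : Test) : Continuous (rightDeriv β φ) :=
  continuous_conv (integrable_unitKernel_neg hβ) (testDeriv φ)

/-- The map taking `φ` to the derivatives of its left and right fractional integrals. -/
noncomputable def pairDeriv (hβ : 0 < β) : Test →ₗ[ℝ] L2 × L2 :=
  (convDerivL2 (integrable_unitKernel hβ)).prod (convDerivL2 (integrable_unitKernel_neg hβ))

theorem norm_pairDeriv_fst_sq_le (hβ : 0 < β) (hβ1 : β ≤ 1) (φ : Test) :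
    ‖(pairDeriv hβ φ).1‖ ^ 2 ≤ (2 * Real.pi) ^ (2 - 2 * β) * energy (1 - β) φ := by
  rw [← real_inner_self_eq_norm_sq]
  exact (inner_contL2_contL2 (continuous_leftDeriv hβ φ)
    (continuous_leftDeriv hβ φ)).trans_le (setIntegral_leftDeriv_sq_le hβ hβ1 φ)

theorem norm_pairDeriv_snd_sq_le (hβ : 0 < β) (hβ1 : β ≤ 1) (φ : Test) :
    ‖(pairDeriv hβ φ).2‖ ^ 2 ≤ (2 * Real.pi) ^ (2 - 2 * β) * energy (1 - β) φ := by
  rw [← real_inner_self_eq_norm_sq]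
  exact (inner_contL2_contL2 (continuous_rightDeriv hβ φ)
    (continuous_rightDeriv hβ φ)).trans_le (setIntegral_rightDeriv_sq_le hβ hβ1 φ)

theorem norm_pairDeriv_sq_le (hβ : 0 < β) (hβ1 : β ≤ 1) (φ : Test) :
    ‖pairDeriv hβ φ‖ ^ 2 ≤ (2 * Real.pi) ^ (2 - 2 * β) * energy (1 - β) φ := by
  rcases max_cases ‖(pairDeriv hβ φ).1‖ ‖(pairDeriv hβ φ).2‖ with h | h
  · rw [Prod.norm_def, h.1]
    exact norm_pairDeriv_fst_sq_le hβ hβ1 φ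
  · rw [Prod.norm_def, h.1]
    exact norm_pairDeriv_snd_sq_le hβ hβ1 φ

theorem le_inner_pairDeriv (hβ : 0 < β) (hβ1 : β ≤ 1 / 2) (φ : Test) :
    Real.cos (β * Real.pi) * ((2 * Real.pi) ^ (2 - 2 * β) * energy (1 - β) φ)
      ≤ inner ℝ (pairDeriv hβ φ).1 (pairDeriv hβ φ).2 :=
  (le_setIntegral_leftDeriv_mul_rightDeriv hβ hβ1 φ).trans_eq (inner_contL2_contL2
    (continuous_leftDeriv hβ φ) (continuous_rightDeriv hβ φ)).symm

/-- Both one-sided forms have the same lower bound, hence so does every convex combination. -/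
theorem le_inner_pairDeriv_testDerivL2 (hβ : 0 < β) (hβ1 : β ≤ 1) {θ : ℝ} (hθ0 : 0 ≤ θ)
    (hθ1 : θ ≤ 1) (φ : Test) :
    Real.cos (β * (Real.pi / 2)) * ((2 * Real.pi) ^ (2 - β) * energy (1 - β / 2) φ)
      ≤ inner ℝ (θ • (pairDeriv hβ φ).1 + (1 - θ) • (pairDeriv hβ φ).2) (testDerivL2 φ) := by
  have h1 := (le_setIntegral_leftDeriv_mul_testDeriv hβ hβ1 φ).trans_eq
    (inner_contL2_contL2 (continuous_leftDeriv hβ φ)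
      (testDeriv φ).continuous).symm
  have h2 := (le_setIntegral_rightDeriv_mul_testDeriv hβ hβ1 φ).trans_eq
    (inner_contL2_contL2 (continuous_rightDeriv hβ φ)
      (testDeriv φ).continuous).symm
  rw [inner_add_left, real_inner_smul_left, real_inner_smul_left]
  have h3 := mul_le_mul_of_nonneg_left h1 hθ0
  have h4 := mul_le_mul_of_nonneg_left h2 (sub_nonneg.2 hθ1)
  refine le_trans (le_of_eq ?_) (add_le_add h3 h4)
  ring

/-- The closure of the pairs of derivatives of fractional integrals; it is isomorphic to
`H^{1-β}₀(0, 1)`. -/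
noncomputable def pairSpace (hβ : 0 < β) : Submodule ℝ (L2 × L2) :=
  (LinearMap.range (pairDeriv hβ)).topologicalClosure

instance (hβ : 0 < β) : CompleteSpace (pairSpace hβ) :=
  (Submodule.isClosed_topologicalClosure _).completeSpace_coe

theorem pairDeriv_mem (hβ : 0 < β) (φ : Test) : pairDeriv hβ φ ∈ pairSpace hβ :=
  Submodule.le_topologicalClosure _ ⟨φ, rfl⟩

theorem exists_seq_pairDeriv (hβ : 0 < β) {v : L2 × L2} (hv : v ∈ pairSpace hβ) :
    ∃ φ : ℕ → Test, Tendsto (fun n => pairDeriv hβ (φ n)) atTop (𝓝 v) := by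
  obtain ⟨y, hy, hlim⟩ := mem_closure_iff_seq_limit.1 hv
  choose φ hφ using hy
  exact ⟨φ, by simpa only [hφ] using hlim⟩

/-! ### Coercivity on the space of derivative pairs -/

theorem cos_pos_of_lt (hβ : 0 < β) (hβ1 : β < 1 / 2) : 0 < Real.cos (β * Real.pi) :=
  Real.cos_pos_of_mem_Ioo ⟨by nlinarith [Real.pi_pos], by nlinarith [Real.pi_pos]⟩

theorem cos_mul_norm_sq_le (hβ : 0 < β) (hβ1 : β < 1 / 2) {v : L2 × L2} (hv : v ∈ pairSpace hβ) :
    Real.cos (β * Real.pi) * ‖v‖ ^ 2 ≤ inner ℝ v.1 v.2 := by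
  obtain ⟨φ, hφ⟩ := exists_seq_pairDeriv hβ hv
  refine le_of_tendsto_of_tendsto' ((hφ.norm.pow 2).const_mul _)
    (((continuous_fst.tendsto v).comp hφ).inner ((continuous_snd.tendsto v).comp hφ)) fun n => ?_
  refine le_trans ?_ (le_inner_pairDeriv hβ hβ1.le (φ n))
  have := (cos_pos_of_lt hβ hβ1).le
  gcongr
  exact norm_pairDeriv_sq_le hβ (by linarith) (φ n)

/-- The derivative of the two-sided fractional integral, as an operator on `pairSpace`. -/
noncomputable def pairOp (hβ : 0 < β) (θ : ℝ) : pairSpace hβ →L[ℝ] L2 :=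
  θ • ((ContinuousLinearMap.fst ℝ L2 L2).comp (pairSpace hβ).subtypeL)
    + (1 - θ) • ((ContinuousLinearMap.snd ℝ L2 L2).comp (pairSpace hβ).subtypeL)

theorem pairOp_apply (hβ : 0 < β) (θ : ℝ) (v : pairSpace hβ) :
    pairOp hβ θ v = θ • (v : L2 × L2).1 + (1 - θ) • (v : L2 × L2).2 := rfl

theorem norm_le_pairOp (hβ : 0 < β) (hβ1 : β < 1 / 2) {θ : ℝ} (hθ0 : 0 ≤ θ) (hθ1 : θ ≤ 1)
    (v : pairSpace hβ) : Real.cos (β * Real.pi) / 2 * ‖v‖ ≤ ‖pairOp hβ θ v‖ := by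
  rcases (norm_nonneg v).eq_or_lt with h0 | h0
  · rw [← h0, mul_zero]
    exact norm_nonneg _
  have h1 := cos_mul_norm_sq_le hβ hβ1 v.2
  obtain ⟨⟨v1, v2⟩, hv⟩ := v
  rw [pairOp_apply]
  simp only [Submodule.coe_norm] at h0 h1 ⊢
  set N := ‖(v1, v2)‖ with hN
  have h2 : ‖v1‖ ≤ N := norm_fst_le (v1, v2)
  have h3 : ‖v2‖ ≤ N := norm_snd_le (v1, v2)
  -- The right side is θ‖v1‖² + (1-θ)‖v2‖² + ⟨v1, v2⟩. The factor 1/2 in the lower bound comes from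
  -- ‖v1‖ + ‖v2‖ ≤ 2N in the maximum norm.
  have h4 : inner ℝ v1 v2 ≤ inner ℝ (θ • v1 + (1 - θ) • v2) (v1 + v2) := by
    simp only [inner_add_left, inner_add_right, real_inner_smul_left, real_inner_self_eq_norm_sq,
      real_inner_comm v1 v2]
    have h5 := mul_nonneg hθ0 (sq_nonneg ‖v1‖)
    have h6 := mul_nonneg (sub_nonneg.2 hθ1) (sq_nonneg ‖v2‖)
    linarith
  have h5 := (real_inner_le_norm (θ • v1 + (1 - θ) • v2) (v1 + v2)).trans
    (mul_le_mul_of_nonneg_left (norm_add_le v1 v2) (norm_nonneg _))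
  have h6 : ‖θ • v1 + (1 - θ) • v2‖ * (‖v1‖ + ‖v2‖) ≤ ‖θ • v1 + (1 - θ) • v2‖ * (2 * N) := by
    gcongr
    linarith
  have h7 : Real.cos (β * Real.pi) * N * N ≤ 2 * ‖θ • v1 + (1 - θ) • v2‖ * N := by linarith
  have h8 := le_of_mul_le_mul_right h7 h0
  linarith

/-! ### The method of continuity -/

section

variable {V H : Type*} [NormedAddCommGroup V] [NormedSpace ℝ V] [CompleteSpace V]
  [NormedAddCommGroup H] [NormedSpace ℝ H] [CompleteSpace H]

/-- The lower bound makes `T` invertible with inverse of norm at most 1/c. Then T' = (1 - S)T with S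
= (T - T')T⁻¹ of norm below one, and 1 - S is invertible by the Neumann series. -/
theorem surjective_of_norm_sub_lt {T T' : V →L[ℝ] H} {c : ℝ} (hc : 0 < c)
    (hT : ∀ v, c * ‖v‖ ≤ ‖T v‖) (hs : Function.Surjective T) (h : ‖T - T'‖ < c) :
    Function.Surjective T' := by
  have hinj : Function.Injective T := by
    refine (injective_iff_map_eq_zero T).2 fun v hv => ?_
    have := hT v
    rw [hv, norm_zero] at this
    exact norm_eq_zero.1 (le_antisymm (nonpos_of_mul_nonpos_right this hc) (norm_nonneg _))
  let e : V ≃L[ℝ] H := ContinuousLinearEquiv.ofBijective T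
    (LinearMap.ker_eq_bot.2 hinj) (LinearMap.range_eq_top.2 hs)
  have he (v : V) : e v = T v := rfl
  have hsymm : ‖(e.symm : H →L[ℝ] V)‖ ≤ c⁻¹ := by
    refine ContinuousLinearMap.opNorm_le_bound _ (by positivity) fun y => ?_
    have := hT (e.symm y)
    rw [← he, e.apply_symm_apply] at this
    rw [← div_eq_inv_mul, le_div_iff₀ hc, mul_comm]
    exact this
  set S : H →L[ℝ] H := (T - T').comp (e.symm : H →L[ℝ] V) with hS
  have hS1 : ‖S‖ < 1 := by
    calc ‖S‖ ≤ ‖T - T'‖ * ‖(e.symm : H →L[ℝ] V)‖ := ContinuousLinearMap.opNorm_comp_le _ _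
      _ ≤ ‖T - T'‖ * c⁻¹ := by gcongr
      _ < c * c⁻¹ := by gcongr
      _ = 1 := mul_inv_cancel₀ hc.ne'
  obtain ⟨U, hU⟩ := isUnit_one_sub_of_norm_lt_one hS1
  intro y
  have h1 : (1 - S) ((↑U⁻¹ : H →L[ℝ] H) y) = y := by
    rw [← hU]
    exact DFunLike.congr_fun U.mul_inv y
  refine ⟨e.symm ((↑U⁻¹ : H →L[ℝ] H) y), ?_⟩
  have h2 (z : H) : (1 - S) z = T' (e.symm z) := by
    simp [hS, ← he]
  rw [← h2, h1]

theorem surjective_of_continuity {A B : V →L[ℝ] H} {c : ℝ} (hc : 0 < c)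
    (hb : ∀ t : ℝ, 0 ≤ t → t ≤ 1 → ∀ v, c * ‖v‖ ≤ ‖(t • A + (1 - t) • B) v‖) {θ : ℝ}
    (hθ0 : 0 ≤ θ) (hθ1 : θ ≤ 1) (hs : Function.Surjective (θ • A + (1 - θ) • B)) :
    Function.Surjective A := by
  -- Go from `θ` to 1 in `N` equal steps; each moves the operator by less than `c`.
  obtain ⟨N, hN⟩ := exists_nat_gt (‖A - B‖ / c)
  have hN0 : (0 : ℝ) < N := (div_nonneg (norm_nonneg _) hc.le).trans_lt hN
  have key : ∀ k : ℕ, k ≤ N →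
      Function.Surjective ((θ + k * ((1 - θ) / N)) • A + (1 - (θ + k * ((1 - θ) / N))) • B) := by
    intro k
    induction k with
    | zero => intro _; simpa using hs
    | succ k ih =>
      intro hk
      have hk' : (k : ℝ) ≤ N := by exact_mod_cast (Nat.le_succ k).trans hk
      have h1 : 0 ≤ (1 - θ) / N := div_nonneg (by linarith) hN0.le
      have h2 : k * ((1 - θ) / N) ≤ 1 - θ := by
        calc k * ((1 - θ) / N) ≤ N * ((1 - θ) / N) := by gcongr
          _ = 1 - θ := by field_simp
      refine surjective_of_norm_sub_lt hc (hb _ (by positivity) (by linarith))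
        (ih ((Nat.le_succ k).trans hk)) ?_
      have e : (θ + k * ((1 - θ) / N)) • A + (1 - (θ + k * ((1 - θ) / N))) • B
          - ((θ + (k + 1 : ℕ) * ((1 - θ) / N)) • A + (1 - (θ + (k + 1 : ℕ) * ((1 - θ) / N))) • B)
          = (-((1 - θ) / N)) • (A - B) := by
        push_cast
        module
      rw [e, norm_smul, norm_neg, Real.norm_of_nonneg h1]
      calc (1 - θ) / N * ‖A - B‖ ≤ 1 / N * ‖A - B‖ := by gcongr; linarith
        _ < c := by
          rw [div_lt_iff₀ hc] at hN
          rw [one_div, ← div_eq_inv_mul, div_lt_iff₀ hN0]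
          linarith
  have h := key N le_rfl
  have e : θ + N * ((1 - θ) / N) = 1 := by field_simp; ring
  rw [e] at h
  simpa using h

end

/-! ### The left operator is not onto -/

theorem memLp_one_sub_rpow (hβ1 : β < 1 / 2) :
    MemLp (fun x : ℝ => (1 - x) ^ (-β)) 2 vol01 := by
  have hm : AEStronglyMeasurable (fun x : ℝ => (1 - x) ^ (-β)) vol01 :=
    Measurable.aestronglyMeasurable (by fun_prop)
  rw [memLp_two_iff_integrable_sq hm]
  have h1 : IntegrableOn (fun t : ℝ => t ^ (-(2 * β))) (Ioo 0 1) :=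
    (intervalIntegral.integrableOn_Ioo_rpow_iff one_pos).2 (by linarith)
  have h2 := ((integrable_indicator_iff measurableSet_Ioo).2 h1).comp_sub_left (1 : ℝ)
  refine (h2.integrableOn (s := Ioo (0 : ℝ) 1)).congr_fun (fun x hx => ?_) measurableSet_Ioo
  have hx' : 1 - x ∈ Ioo (0 : ℝ) 1 := ⟨by linarith [hx.2], by linarith [hx.1]⟩
  simp only [indicator_of_mem hx']
  rw [← Real.rpow_two, ← Real.rpow_mul hx'.1.le]
  ring_nf

/-- The function `(1 - x)^(-β)` in `L²(0, 1)`. -/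
noncomputable def edgeL2 (hβ1 : β < 1 / 2) : L2 := (memLp_one_sub_rpow hβ1).toLp _

theorem coeFn_edgeL2 (hβ1 : β < 1 / 2) :
    edgeL2 hβ1 =ᵐ[vol01] fun x => (1 - x) ^ (-β) := MemLp.coeFn_toLp _

theorem edgeL2_ne_zero (hβ1 : β < 1 / 2) : edgeL2 hβ1 ≠ 0 := by
  intro h
  have h1 : ∀ᵐ x ∂vol01, False := by
    filter_upwards [coeFn_edgeL2 hβ1, Lp.coeFn_zero ℝ 2 vol01, ae_restrict_mem measurableSet_Ioo]
      with x h1 h2 h3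
    rw [h, h2] at h1
    exact (Real.rpow_pos_of_pos (sub_pos.2 h3.2) (-β)).ne h1
  have h2 : vol01 = 0 := ae_eq_bot.1 (eventually_false_iff_eq_bot.1 h1)
  have h3 : vol01 univ = 1 := by simp
  simp [h2] at h3

/-- The extension by zero of `(1 - x)^(-β)`. -/
noncomputable def edgeFun (β : ℝ) : ℝ → ℝ := (Ioo (0 : ℝ) 1).indicator fun x => (1 - x) ^ (-β)

theorem integrable_edgeFun (hβ1 : β < 1 / 2) : Integrable (edgeFun β) :=
  (integrable_indicator_iff measurableSet_Ioo).2
    ((memLp_one_sub_rpow hβ1).integrable (by norm_num))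

/-- Under x = s + (1-s)t the powers of 1-s are -β, β-1 and 1 (the Jacobian), and they cancel. So the
right fractional integral of (1-x)^(-β) is constant; its value is never needed. -/
theorem integral_edgeFun_mul_unitKernel {s : ℝ} (hs : s ∈ Ioo (0 : ℝ) 1) :
    ∫ x, edgeFun β x * unitKernel β (x - s) = ∫ t, edgeFun β t * unitKernel β t := by
  have hs' : 0 < 1 - s := sub_pos.2 hs.2
  have h1 : ∫ x, edgeFun β x * unitKernel β (x - s)
      = ∫ y, edgeFun β (s + y) * unitKernel β y := by
    rw [← integral_add_left_eq_self _ s]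
    simp
  have h2 := Measure.integral_comp_mul_left (fun y => edgeFun β (s + y) * unitKernel β y) (1 - s)
  rw [abs_of_pos (inv_pos.2 hs'), smul_eq_mul] at h2
  rw [h1, ← mul_right_inj' (inv_pos.2 hs').ne', ← h2, ← integral_const_mul]
  congr 1
  ext t
  by_cases ht : t ∈ Ioo (0 : ℝ) 1
  · have h3 : s + (1 - s) * t ∈ Ioo (0 : ℝ) 1 :=
      ⟨by nlinarith [hs.1, ht.1], by nlinarith [mul_pos hs' (sub_pos.2 ht.2)]⟩
    have h4 : (1 - s) * t ∈ Ioo (0 : ℝ) 1 := ⟨mul_pos hs' ht.1, by linarith [h3.2, hs.1]⟩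
    simp only [edgeFun, unitKernel, indicator_of_mem h3, indicator_of_mem h4, indicator_of_mem ht]
    rw [show 1 - (s + (1 - s) * t) = (1 - s) * (1 - t) by ring,
      Real.mul_rpow hs'.le (sub_pos.2 ht.2).le, Real.mul_rpow hs'.le ht.1.le,
      show β - 1 = -1 - -β by ring, Real.rpow_sub hs', Real.rpow_neg_one]
    have := (Real.rpow_pos_of_pos hs' (-β)).ne'
    field_simp
  · have h5 : edgeFun β t = 0 := indicator_of_notMem ht _
    rw [h5, zero_mul, mul_zero]
    by_cases h0 : 0 < t
    · have h6 : s + (1 - s) * t ∉ Ioo (0 : ℝ) 1 := by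
        intro h
        have : 1 ≤ t := by
          by_contra! h'
          exact ht ⟨h0, h'⟩
        nlinarith [h.2]
      rw [edgeFun, indicator_of_notMem h6, zero_mul]
    · have h6 : (1 - s) * t ∉ Ioo (0 : ℝ) 1 := by
        intro h
        nlinarith [h.1]
      rw [unitKernel, indicator_of_notMem h6, mul_zero]

/-- Fubini moves the left fractional integral off φ' and turns it into the right one of (1-x)^(-β).
That is constant, and φ' integrates to zero. -/
theorem inner_edgeL2_pairDeriv (hβ : 0 < β) (hβ1 : β < 1 / 2) (φ : Test) :
    inner ℝ (edgeL2 hβ1) (pairDeriv hβ φ).1 = 0 := by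
  have hK := integrable_unitKernel hβ
  have hg := integrable_edgeFun hβ1
  obtain ⟨C, -, hC⟩ := (testDeriv φ).exists_bound
  have h1 : inner ℝ (edgeL2 hβ1) (pairDeriv hβ φ).1
      = ∫ x, edgeFun β x * (unitKernel β ⋆ᵣ (testDeriv φ)) x := by
    refine (inner_contL2 _ (continuous_leftDeriv hβ φ)).trans ?_
    rw [← integral_indicator measurableSet_Ioo]
    have := (ae_restrict_iff' measurableSet_Ioo).1 (coeFn_edgeL2 hβ1)
    refine integral_congr_ae ?_
    filter_upwards [this] with x hx
    by_cases h : x ∈ Ioo (0 : ℝ) 1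
    · rw [indicator_of_mem h, hx h, edgeFun, indicator_of_mem h]
      rfl
    · rw [indicator_of_notMem h, edgeFun, indicator_of_notMem h, zero_mul]
  have h2 : ∀ x, edgeFun β x * (unitKernel β ⋆ᵣ (testDeriv φ)) x
      = ∫ s, edgeFun β x * unitKernel β (x - s) * testDeriv φ s := by
    intro x
    rw [convolution_eq_swap, ← integral_const_mul]
    simp only [ContinuousLinearMap.mul_apply', mul_assoc]
  have hprod : Integrable (fun p : ℝ × ℝ => edgeFun β p.1 * unitKernel β (p.1 - p.2)
      * testDeriv φ p.2) (volume.prod volume) := by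
    have h3 := (hg.convolution_integrand (ContinuousLinearMap.mul ℝ ℝ)
      (integrable_unitKernel_neg hβ)).swap
    have h4 := h3.mul_bdd (c := C) (g := fun p : ℝ × ℝ => testDeriv φ p.2)
      ((testDeriv φ).continuous.comp continuous_snd).aestronglyMeasurable
      (ae_of_all _ fun p => hC _)
    refine h4.congr (ae_of_all _ fun p => ?_)
    simp
  rw [h1]
  simp only [h2]
  rw [integral_integral_swap hprod]
  have h5 : ∀ s, ∫ x, edgeFun β x * unitKernel β (x - s) * testDeriv φ s
      = (∫ t, edgeFun β t * unitKernel β t) * testDeriv φ s := by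
    intro s
    rw [integral_mul_const]
    by_cases hs : s ∈ Ioo (0 : ℝ) 1
    · rw [integral_edgeFun_mul_unitKernel hs]
    · rw [(testDeriv φ).eq_zero_of_notMem hs, mul_zero, mul_zero]
  simp only [h5]
  rw [integral_const_mul]
  have h6 := integral_mul_deriv_test (F := fun _ => 1) (F' := fun _ => 0)
    (fun x => hasDerivAt_const x 1) continuous_const φ
  simp only [one_mul, zero_mul, integral_zero, neg_zero] at h6
  rw [← coe_testDeriv, setIntegral_eq_integral_of_forall_compl_eq_zero fun x hx =>
    (testDeriv φ).eq_zero_of_notMem hx] at h6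
  rw [h6, mul_zero]

theorem not_surjective_fst (hβ : 0 < β) (hβ1 : β < 1 / 2) :
    ¬ Function.Surjective
      ((ContinuousLinearMap.fst ℝ L2 L2).comp (pairSpace hβ).subtypeL) := by
  intro hs
  obtain ⟨⟨v, hv⟩, h⟩ := hs (edgeL2 hβ1)
  have h' : v.1 = edgeL2 hβ1 := h
  obtain ⟨φ, hφ⟩ := exists_seq_pairDeriv hβ hv
  have h1 : inner ℝ (edgeL2 hβ1) v.1 = 0 := by
    refine tendsto_nhds_unique
      (tendsto_const_nhds.inner ((continuous_fst.tendsto v).comp hφ)) ?_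
    simp only [Function.comp_def, inner_edgeL2_pairDeriv]
    exact tendsto_const_nhds
  rw [h', inner_self_eq_zero] at h1
  exact edgeL2_ne_zero hβ1 h1

/-! ### Solvability modulo constants -/

theorem norm_testL2_sq_le_norm_testDerivL2_sq (φ : Test) :
    ‖testL2 φ‖ ^ 2 ≤ 2 * 4 ^ (2 * (1 : ℝ)) * (1 / (2 * Real.pi) ^ 2 * ‖testDerivL2 φ‖ ^ 2) := by
  refine (norm_testL2_sq_le zero_le_one le_rfl φ).trans ?_
  gcongr
  exact energy_one_le φ

theorem exists_norm_pairDeriv_sq_le (hβ : 0 < β) (hβ1 : β ≤ 1) :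
    ∃ C : ℝ, ∀ φ, ‖pairDeriv hβ φ‖ ^ 2 ≤ C * ‖testDerivL2 φ‖ ^ 2 := by
  refine ⟨(2 * Real.pi) ^ (2 - 2 * β) * (2 * 4 ^ (2 * (1 : ℝ)) * (1 / (2 * Real.pi) ^ 2)
    + 1 / (2 * Real.pi) ^ 2), fun φ => ?_⟩
  refine (norm_pairDeriv_sq_le hβ hβ1 φ).trans ?_
  rw [mul_assoc]
  gcongr
  refine (energy_le (by linarith) (by linarith) φ).trans ?_
  rw [← norm_testL2_sq, add_mul]
  refine add_le_add ?_ (energy_one_le φ)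
  refine (norm_testL2_sq_le_norm_testDerivL2_sq φ).trans (le_of_eq ?_)
  ring

/-- Choose φ_n' → h. Orthogonality replaces ⟨Tφ_n, φ_n'⟩ by ⟨Tφ_n, φ_n' - h⟩, which tends to zero
because Tφ_n is bounded. Coercivity of order 1 - β/2 with Poincaré gives φ_n → 0 in L², and
closedness of the weak derivative gives h = 0. -/
theorem eq_zero_of_inner_pairOp_eq_zero (hβ : 0 < β) (hβ1 : β < 1) {θ : ℝ} (hθ0 : 0 ≤ θ)
    (hθ1 : θ ≤ 1) {h : L2} (h1 : inner ℝ oneL2 h = 0)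
    (h2 : ∀ v, inner ℝ (pairOp hβ θ v) h = 0) : h = 0 := by
  obtain ⟨φ, hφ⟩ := exists_seq_testDerivL2 h1
  set T : ℕ → L2 := fun n => pairOp hβ θ ⟨pairDeriv hβ (φ n), pairDeriv_mem hβ (φ n)⟩ with hT
  obtain ⟨C, hC⟩ := exists_norm_pairDeriv_sq_le hβ hβ1.le
  obtain ⟨M, hM⟩ : ∃ M, ∀ n, ‖T n‖ ≤ M := by
    obtain ⟨B, hB⟩ := hφ.norm.bddAbove_range
    refine ⟨‖pairOp hβ θ‖ * Real.sqrt (|C| * B ^ 2), fun n => ?_⟩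
    refine ((pairOp hβ θ).le_opNorm _).trans ?_
    gcongr
    refine Real.le_sqrt_of_sq_le ((hC (φ n)).trans ?_)
    have := hB ⟨n, rfl⟩
    gcongr
    exact le_abs_self C
  have hlim : Tendsto (fun n => inner ℝ (T n) (testDerivL2 (φ n))) atTop (𝓝 0) := by
    have hd := tendsto_iff_norm_sub_tendsto_zero.1 hφ
    refine squeeze_zero_norm (fun n => ?_) (by simpa using hd.const_mul M)
    have e : inner ℝ (T n) (testDerivL2 (φ n)) = inner ℝ (T n) (testDerivL2 (φ n) - h) := by
      rw [inner_sub_right, hT, h2, sub_zero]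
    rw [e]
    refine (norm_inner_le_norm _ _).trans ?_
    gcongr
    exact hM n
  have hs0 : 0 ≤ 1 - β / 2 := by linarith
  have hcos : 0 < Real.cos (β * (Real.pi / 2)) * (2 * Real.pi) ^ (2 - β) := by
    have : 0 < Real.cos (β * (Real.pi / 2)) :=
      Real.cos_pos_of_mem_Ioo ⟨by nlinarith [Real.pi_pos], by nlinarith [Real.pi_pos]⟩
    positivity
  have hE : Tendsto (fun n => energy (1 - β / 2) (φ n)) atTop (𝓝 0) := by
    have := hlim.const_mul (Real.cos (β * (Real.pi / 2)) * (2 * Real.pi) ^ (2 - β))⁻¹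
    rw [mul_zero] at this
    refine squeeze_zero (fun n => energy_nonneg _ _) (fun n => ?_) this
    rw [← div_eq_inv_mul, le_div_iff₀ hcos, mul_comm, mul_assoc]
    exact le_inner_pairDeriv_testDerivL2 hβ hβ1.le hθ0 hθ1 (φ n)
  have hzero : Tendsto (fun n => testL2 (φ n)) atTop (𝓝 0) := by
    rw [tendsto_zero_iff_norm_tendsto_zero]
    have h3 : Tendsto (fun n => ‖testL2 (φ n)‖ ^ 2) atTop (𝓝 0) :=
      squeeze_zero (fun n => sq_nonneg _) (fun n => norm_testL2_sq_le hs0 (by linarith) (φ n))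
        (by simpa using hE.const_mul (2 * (4 : ℝ) ^ (2 * (1 - β / 2))))
    have h4 := (Real.continuous_sqrt.tendsto _).comp h3
    simpa [Function.comp_def] using h4
  have hw := HasWeakDeriv.of_tendsto (fun n => hasWeakDeriv_test (φ n)) hzero hφ
  have h0 : HasWeakDeriv 0 0 := by simpa using hasWeakDeriv_oneL2.smul 0
  exact hw.unique h0

theorem isClosed_range_pairOp (hβ : 0 < β) (hβ1 : β < 1 / 2) {θ : ℝ} (hθ0 : 0 ≤ θ)
    (hθ1 : θ ≤ 1) : IsClosed (LinearMap.range (pairOp hβ θ).toLinearMap : Set L2) := by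
  have hc : 0 < Real.cos (β * Real.pi) / 2 := half_pos (cos_pos_of_lt hβ hβ1)
  have ha : AntilipschitzWith (Real.toNNReal (Real.cos (β * Real.pi) / 2)⁻¹) (pairOp hβ θ) := by
    refine ContinuousLinearMap.antilipschitz_of_bound _ fun v => ?_
    rw [Real.coe_toNNReal _ (inv_pos.2 hc).le, ← div_eq_inv_mul, le_div_iff₀ hc, mul_comm]
    exact norm_le_pairOp hβ hβ1 hθ0 hθ1 v
  exact ha.isClosed_range (pairOp hβ θ).uniformContinuous

theorem exists_eq_pairOp_add (hβ : 0 < β) (hβ1 : β < 1 / 2) {θ : ℝ} (hθ0 : 0 ≤ θ)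
    (hθ1 : θ ≤ 1) (h : L2) : ∃ (v : pairSpace hβ) (a : ℝ), h = pairOp hβ θ v + a • oneL2 := by
  set S := LinearMap.range (pairOp hβ θ).toLinearMap ⊔ Submodule.span ℝ {oneL2} with hS
  have hcl : IsClosed (S : Set L2) :=
    Submodule.isClosed_sup_finiteDimensional _ _ (isClosed_range_pairOp hβ hβ1 hθ0 hθ1)
  have : CompleteSpace S := hcl.completeSpace_coe
  have htop : S = ⊤ := by
    rw [← Submodule.orthogonal_eq_bot_iff, eq_bot_iff]
    intro g hg
    rw [Submodule.mem_orthogonal] at hg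
    refine (Submodule.mem_bot ℝ).2
      (eq_zero_of_inner_pairOp_eq_zero hβ (by linarith) hθ0 hθ1 ?_ fun v => ?_)
    · exact hg _ (Submodule.mem_sup_right (Submodule.mem_span_singleton_self _))
    · exact hg _ (Submodule.mem_sup_left ⟨v, rfl⟩)
  have hmem : h ∈ S := htop ▸ Submodule.mem_top
  obtain ⟨y, ⟨v, rfl⟩, z, hz, rfl⟩ := Submodule.mem_sup.1 hmem
  obtain ⟨a, rfl⟩ := Submodule.mem_span_singleton.1 hz
  exact ⟨v, a, rfl⟩

/-- For a = 0 this is the lower bound. For a ≠ 0 the constants lie in the range, so the operator is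
onto; continuity carries this to θ = 1, where it fails. -/
theorem eq_zero_of_pairOp_eq_smul (hβ : 0 < β) (hβ1 : β < 1 / 2) {θ : ℝ} (hθ0 : 0 ≤ θ)
    (hθ1 : θ ≤ 1) {v : pairSpace hβ} {a : ℝ} (h : pairOp hβ θ v = a • oneL2) : v = 0 := by
  have hc : 0 < Real.cos (β * Real.pi) / 2 := half_pos (cos_pos_of_lt hβ hβ1)
  rcases eq_or_ne a 0 with rfl | ha
  · have h1 := norm_le_pairOp hβ hβ1 hθ0 hθ1 v
    rw [h, zero_smul, norm_zero] at h1
    exact norm_eq_zero.1 (le_antisymm (nonpos_of_mul_nonpos_right h1 hc) (norm_nonneg _))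
  · refine absurd (surjective_of_continuity hc (fun t ht0 ht1 v => norm_le_pairOp hβ hβ1 ht0 ht1 v)
      hθ0 hθ1 fun y => ?_) (not_surjective_fst hβ hβ1)
    obtain ⟨w, b, hw⟩ := exists_eq_pairOp_add hβ hβ1 hθ0 hθ1 y
    -- The multiple of `v` supplies the constant `b` left over by `w`.
    refine ⟨w + (b / a) • v, ?_⟩
    change pairOp hβ θ (w + (b / a) • v) = y
    rw [map_add, map_smul, h, smul_smul, div_mul_cancel₀ _ ha, hw]

/-! ### The range of the two-sided fractional integral -/

theorem energy_le_norm_pairDeriv_sq (hβ : 0 < β) (hβ1 : β < 1 / 2) (φ : Test) :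
    energy (1 - β) φ
      ≤ (Real.cos (β * Real.pi) * (2 * Real.pi) ^ (2 - 2 * β))⁻¹ * ‖pairDeriv hβ φ‖ ^ 2 := by
  have hc : 0 < Real.cos (β * Real.pi) * (2 * Real.pi) ^ (2 - 2 * β) :=
    mul_pos (cos_pos_of_lt hβ hβ1) (by positivity)
  rw [← div_eq_inv_mul, le_div_iff₀ hc, mul_comm, mul_assoc]
  refine (le_inner_pairDeriv hβ hβ1.le φ).trans ((real_inner_le_norm _ _).trans ?_)
  rw [sq]
  exact mul_le_mul (norm_fst_le _) (norm_snd_le _) (norm_nonneg _) (norm_nonneg _)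

theorem fracInt_ae_eq (β θ : ℝ) (u : L2) :
    fracInt β θ u =ᵐ[vol01] fun x => θ * (unitKernel β ⋆ᵣ zeroExt u) x
      + (1 - θ) * ((fun t => unitKernel β (-t)) ⋆ᵣ zeroExt u) x := by
  filter_upwards [ae_restrict_mem measurableSet_Ioo] with x hx
  rw [fracInt, leftInt_eq_conv β u hx, rightInt_eq_conv β u hx]

/-- The two-sided fractional integral of a limit of test functions and its weak derivative. -/
theorem exists_hasWeakDeriv_fracInt (hβ : 0 < β) (θ : ℝ) {φ : ℕ → Test} {u : L2} {v : L2 × L2}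
    (hu : Tendsto (fun n => testL2 (φ n)) atTop (𝓝 u))
    (hv : Tendsto (fun n => pairDeriv hβ (φ n)) atTop (𝓝 v)) :
    ∃ w : L2, w =ᵐ[vol01] fracInt β θ u ∧ HasWeakDeriv w (θ • v.1 + (1 - θ) • v.2) := by
  have hK := integrable_unitKernel hβ
  have hK' := integrable_unitKernel_neg hβ
  have hl := setIntegral_conv_mul_deriv hK hu ((continuous_fst.tendsto v).comp hv)
  have hr := setIntegral_conv_mul_deriv hK' hu ((continuous_snd.tendsto v).comp hv)
  have hil := hK.integrable_convolution (ContinuousLinearMap.mul ℝ ℝ) (zeroExt_integrable u)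
  have hir := hK'.integrable_convolution (ContinuousLinearMap.mul ℝ ℝ) (zeroExt_integrable u)
  obtain ⟨wl, h1, h2⟩ := exists_hasWeakDeriv_ae_eq hil.integrableOn hl
  obtain ⟨wr, h3, h4⟩ := exists_hasWeakDeriv_ae_eq hir.integrableOn hr
  refine ⟨θ • wl + (1 - θ) • wr, ?_, (h2.smul θ).add (h4.smul (1 - θ))⟩
  filter_upwards [fracInt_ae_eq β θ u, h1, h3, Lp.coeFn_add (θ • wl) ((1 - θ) • wr),
    Lp.coeFn_smul θ wl, Lp.coeFn_smul (1 - θ) wr] with x e0 e1 e2 e3 e4 e5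
  rw [e0, e3, Pi.add_apply, e4, e5, Pi.smul_apply, Pi.smul_apply, e1, e2, smul_eq_mul, smul_eq_mul]

theorem exists_mem_fracRange_D_eq (hβ : 0 < β) (hβ1 : β < 1 / 2) (θ : ℝ) (v : pairSpace hβ) :
    ∃ w ∈ fracRange β θ hβ, D w = pairOp hβ θ v := by
  obtain ⟨φ, hφ⟩ := exists_seq_pairDeriv hβ v.2
  have hE : EnergyCauchy (1 - β) φ :=
    EnergyCauchy.of_norm_sq (energy_le_norm_pairDeriv_sq hβ hβ1) hφ.cauchySeq
  obtain ⟨u, hu⟩ := hE.exists_tendsto (by linarith) (by linarith)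
  obtain ⟨w, h1, h2⟩ := exists_hasWeakDeriv_fracInt hβ θ hu hφ
  exact ⟨⟨w, _, h2⟩, ⟨u, hE.mem_Hzero (by linarith) (by linarith) hu, h1⟩, D_eq h2⟩

/-- The upper energy bound makes the derivative pairs converge. The lower one recovers the density:
if the limiting pair is zero, so is the density and with it `w`. Knowing `D w` alone would fix `w`
only up to a constant. -/
theorem exists_pairOp_eq_D (hβ : 0 < β) (hβ1 : β < 1 / 2) {θ : ℝ} {w : H1}
    (hw : w ∈ fracRange β θ hβ) :
    ∃ v : pairSpace hβ, D w = pairOp hβ θ v ∧ (v = 0 → w = 0) := by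
  obtain ⟨u, hu, hwu⟩ := hw
  obtain ⟨φ, hE, hφ⟩ := exists_energyCauchy (by linarith) (by linarith) hu
  obtain ⟨v, hv⟩ := cauchySeq_tendsto_of_complete
    (cauchySeq_of_forall_norm_sq_le (norm_pairDeriv_sq_le hβ (by linarith)) hE)
  have hmem : v ∈ pairSpace hβ := (Submodule.isClosed_topologicalClosure _).mem_of_tendsto hv
    (Eventually.of_forall fun n => pairDeriv_mem hβ (φ n))
  obtain ⟨w', h1, h2⟩ := exists_hasWeakDeriv_fracInt hβ θ hφ hv
  have hww : (w : L2) = w' := Lp.ext (hwu.trans h1.symm)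
  refine ⟨⟨v, hmem⟩, D_eq (hww ▸ h2), fun h0 => ?_⟩
  have hv0 : v = 0 := congrArg Subtype.val h0
  subst hv0
  have hu0 : u = 0 := by
    have h3 : ‖u‖ ^ 2 ≤ 0 := by
      have h4 := (((hv.norm.pow 2).const_mul
        (Real.cos (β * Real.pi) * (2 * Real.pi) ^ (2 - 2 * β))⁻¹).const_mul
        (2 * (4 : ℝ) ^ (2 * (1 - β))))
      have h5 := le_of_tendsto_of_tendsto' (hφ.norm.pow 2) h4 fun n =>
        (norm_testL2_sq_le (s := 1 - β) (by linarith) (by linarith) (φ n)).trans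
          (by gcongr; exact energy_le_norm_pairDeriv_sq hβ hβ1 _)
      simpa using h5
    rw [← norm_eq_zero]
    exact pow_eq_zero_iff two_ne_zero |>.1 (le_antisymm h3 (sq_nonneg _))
  subst hu0
  have h6 := fracInt_smul (β := β) (θ := θ) 0 0
  rw [zero_smul, zero_smul] at h6
  refine Subtype.ext (Lp.ext ?_)
  filter_upwards [Lp.coeFn_zero ℝ 2 vol01, h6, hwu] with x h7 h8 h9
  rw [h9, h8, ZeroMemClass.coe_zero, h7]

/-! ### The projection onto `H¹₀(0, 1)` -/

/-- The square integrable functions of mean zero. -/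
noncomputable def meanZero : Submodule ℝ L2 := LinearMap.ker (innerₗ L2 oneL2)

/-- Subtraction of the mean. -/
noncomputable def subMean : L2 →ₗ[ℝ] meanZero :=
  LinearMap.codRestrict meanZero (LinearMap.id - (innerₗ L2 oneL2).smulRight oneL2)
    inner_oneL2_sub

theorem coe_subMean (g : L2) : (subMean g : L2) = g - (inner ℝ oneL2 g : ℝ) • oneL2 := rfl

/-- The weak derivative is an isomorphism of `H¹₀(0, 1)` onto the functions of mean zero. -/
noncomputable def derivEquiv : H10 ≃ₗ[ℝ] meanZero :=
  LinearEquiv.ofBijective (LinearMap.codRestrict meanZero (D ∘ₗ H10.subtype) inner_oneL2_D) <| by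
    constructor
    · refine (injective_iff_map_eq_zero _).2 fun w hw => eq_zero_of_D_eq_zero ?_
      exact congrArg Subtype.val hw
    · rintro ⟨g, hg⟩
      obtain ⟨w, hw⟩ := exists_H10_D_eq hg
      exact ⟨w, Subtype.ext hw⟩

theorem coe_derivEquiv (w : H10) : (derivEquiv w : L2) = D (w : H1) := rfl

/-- The `H¹`-projection onto `H¹₀(0, 1)`. -/
noncomputable def h1Projection : H1 →ₗ[ℝ] H10 := derivEquiv.symm.toLinearMap ∘ₗ subMean ∘ₗ D

theorem D_h1Projection (w : H1) :
    D (h1Projection w : H1) = D w - (inner ℝ oneL2 (D w) : ℝ) • oneL2 := by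
  rw [← coe_derivEquiv, ← coe_subMean]
  exact congrArg Subtype.val (derivEquiv.apply_symm_apply _)

theorem isH1Projection_h1Projection : IsH1Projection h1Projection := by
  intro w v
  rw [D_h1Projection, inner_sub_left, real_inner_smul_left, inner_oneL2_D, mul_zero, sub_zero]

theorem IsH1Projection.eq_h1Projection {Q : H1 → H10} (hQ : IsH1Projection Q) :
    Q = h1Projection := by
  ext1 w
  rw [← sub_eq_zero]
  refine eq_zero_of_D_eq_zero (inner_self_eq_zero (𝕜 := ℝ).1 ?_)
  have h := (hQ w (Q w - h1Projection w)).trans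
    (isH1Projection_h1Projection w (Q w - h1Projection w)).symm
  rw [← sub_eq_zero, ← inner_sub_left, ← map_sub] at h
  exact h

theorem mem_ker_h1Projection {w : H1} :
    w ∈ LinearMap.ker h1Projection ↔ ∃ c : ℝ, D w = c • oneL2 := by
  rw [LinearMap.mem_ker]
  constructor
  · intro h
    refine ⟨inner ℝ oneL2 (D w), sub_eq_zero.1 ?_⟩
    rw [← D_h1Projection, h, ZeroMemClass.coe_zero, map_zero]
  · rintro ⟨c, hc⟩
    refine eq_zero_of_D_eq_zero ?_
    rw [D_h1Projection, hc, real_inner_smul_right, real_inner_self_eq_norm_sq, norm_oneL2]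
    simp

theorem wl_add_wr : wl + wr = oneL2 := by
  refine Lp.ext ?_
  filter_upwards [Lp.coeFn_add wl wr, coeFn_contL2 (f := fun x => 1 - x) (by fun_prop),
    coeFn_contL2 (f := fun x => x) (by fun_prop),
    coeFn_contL2 (f := fun _ => 1) continuous_const] with x h1 h2 h3 h4
  rw [h1, Pi.add_apply]
  exact (congrArg₂ (· + ·) h2 h3).trans ((sub_add_cancel 1 x).trans h4.symm)

theorem map_ker_h1Projection :
    (LinearMap.ker h1Projection).map H1.subtype = Submodule.span ℝ {wl, wr} := by
  ext w
  rw [Submodule.mem_span_pair]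
  constructor
  · rintro ⟨w, hw, rfl⟩
    obtain ⟨c, hc⟩ := mem_ker_h1Projection.1 hw
    have h1 : HasWeakDeriv ((w : L2) + (-c) • wr) 0 := by
      have h := (D_spec w).add (hasWeakDeriv_wr.smul (-c))
      rwa [hc, ← add_smul, add_neg_cancel, zero_smul] at h
    obtain ⟨d, hd⟩ := exists_eq_smul_oneL2 fun φ => by
      rw [hasWeakDeriv_iff_inner.1 h1, inner_zero_left, neg_zero]
    -- From w = cx + d and 1 = (1-x) + x.
    refine ⟨d, c + d, ?_⟩
    rw [← wl_add_wr, ← sub_eq_zero] at hd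
    rw [← sub_eq_zero, ← neg_eq_zero, ← hd, Submodule.coe_subtype]
    module
  · rintro ⟨a, b, rfl⟩
    have h := (hasWeakDeriv_wl.smul a).add (hasWeakDeriv_wr.smul b)
    refine ⟨⟨a • wl + b • wr, _, h⟩, mem_ker_h1Projection.2 ⟨b - a, ?_⟩, rfl⟩
    rw [D_eq h]
    module

variable {θ : ℝ}

theorem map_fracRange_h1Projection (hβ : 0 < β) (hβ1 : β < 1 / 2) (hθ0 : 0 ≤ θ) (hθ1 : θ ≤ 1) :
    (fracRange β θ hβ).map h1Projection = ⊤ := by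
  rw [eq_top_iff]
  rintro z -
  obtain ⟨v, a, h⟩ := exists_eq_pairOp_add hβ hβ1 hθ0 hθ1 (D (z : H1))
  obtain ⟨w, hw, hD⟩ := exists_mem_fracRange_D_eq hβ hβ1 θ v
  refine ⟨w, hw, ?_⟩
  rw [← sub_eq_zero]
  refine eq_zero_of_D_eq_zero ?_
  -- The derivative of `z` has mean zero, so `a` must be minus the mean of `pairOp hβ θ v`:
  -- subtracting the mean of `D w` gives exactly `D z`.
  have h0 := inner_oneL2_D z
  rw [h, inner_add_right, real_inner_smul_right, real_inner_self_eq_norm_sq, norm_oneL2] at h0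
  rw [Submodule.coe_sub, map_sub, D_h1Projection, hD, h,
    show inner ℝ oneL2 (pairOp hβ θ v) = -a by linarith]
  module

theorem isCompl_fracRange_ker (hβ : 0 < β) (hβ1 : β < 1 / 2) (hθ0 : 0 ≤ θ) (hθ1 : θ ≤ 1) :
    IsCompl (fracRange β θ hβ) (LinearMap.ker h1Projection) := by
  constructor
  · rw [Submodule.disjoint_def]
    intro w hw hk
    obtain ⟨c, hc⟩ := mem_ker_h1Projection.1 hk
    obtain ⟨v, hv, h0⟩ := exists_pairOp_eq_D hβ hβ1 hw
    exact h0 (eq_zero_of_pairOp_eq_smul hβ hβ1 hθ0 hθ1 (hv.symm.trans hc))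
  · rw [codisjoint_iff, eq_top_iff]
    rintro w -
    have hw : h1Projection w ∈ (fracRange β θ hβ).map h1Projection := by
      rw [map_fracRange_h1Projection hβ hβ1 hθ0 hθ1]
      exact Submodule.mem_top
    obtain ⟨r, hr, he⟩ := hw
    -- Surjectivity on the range provides `r` with the same projection as `w`, so the difference
    -- lies in the kernel.
    refine Submodule.mem_sup.2 ⟨r, hr, w - r, ?_, add_sub_cancel _ _⟩
    rw [LinearMap.mem_ker, map_sub, he, sub_self]

end FracDiff

theorem theorem4p2 (β θ : ℝ) (hβ0 : 0 < β) (hβ1 : β < 1 / 2) (hθ0 : 0 ≤ θ) (hθ1 : θ ≤ 1) :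
    ∃ P : FracDiff.H1 →ₗ[ℝ] FracDiff.H10,
      -- `P` is the `H¹`-projection onto `H¹₀`, which exists, is unique, and is linear
      (FracDiff.IsH1Projection P ∧
        ∀ Q : FracDiff.H1 → FracDiff.H10, FracDiff.IsH1Projection Q → Q = P) ∧
      -- `N(P) = span {1 - x, x}`
      (LinearMap.ker P).map FracDiff.H1.subtype = Submodule.span ℝ {FracDiff.wl, FracDiff.wr} ∧
      -- `P (R(I^β_θ)) = H¹₀(0, 1)`
      (FracDiff.fracRange β θ hβ0).map P = ⊤ ∧
      -- `H¹(0, 1) = R(I^β_θ) ⊕ N(P)`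
      IsCompl (FracDiff.fracRange β θ hβ0) (LinearMap.ker P) :=
  ⟨FracDiff.h1Projection,
    ⟨FracDiff.isH1Projection_h1Projection, fun _ hQ => hQ.eq_h1Projection⟩,
    FracDiff.map_ker_h1Projection,
    FracDiff.map_fracRange_h1Projection hβ0 hβ1 hθ0 hθ1,
    FracDiff.isCompl_fracRange_ker hβ0 hβ1 hθ0 hθ1⟩
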